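/- Work with polynomials over $\mathbb C$ in the times $t=(t_1,t_2,t_3,\dots)$. Put $[z^{-1}]=(z^{-1},\tfrac{z^{-2}}2,\tfrac{z^{-3}}3,\dots)$ and $[z^{-1}]_{odd}=(z^{-1},0,\tfrac{z^{-3}}3,0,\dots)$, and let $\mathrm{Res}\,\sum_i f_iz^i\,dz=f_{-1}$. A polynomial KP tau-function is a polynomial $\tau\neq0$ with $$\mathrm{Res}\;\tau(t-[z^{-1}])\,\tau(y+[z^{-1}])\,e^{\sum_{i\ge1}(t_i-y_i)z^i}\,dz=0\quad\text{for all }t,y;$$ it is a polynomial KdV tau-function if moreover it does not depend on the even times $t_2,t_4,\dots$. A polynomial BKP tau-function is a polynomial $\tau\ne0$ in the odd times $t_1,t_3,\dots$ only with $$\mathrm{Res}\;\tau(t-2[z^{-1}]_{odd})\,\tau(y+2[z^{-1}]_{odd})\,e^{\sum_{i\text{ odd}}(t_i-y_i)z^i}\,\frac{dz}z=\tau(t)\tau(y)\quad\text{for all }t,y.$$ Let $s_n(t)$ be given by $\sum_{n\ge0}s_n(t)z^n=e^{\sum_{i\ge1}t_iz^i}$ and $s_n=0$ for $n<0$, and let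 $s_\lambda(t)=\det(s_{\lambda_i-i+j}(t))$ be the Schur function of a partition $\lambda$. Let $Q_\lambda(t)$ be the Schur Q-function of a strict partition $\lambda$, written in the times $t_i=\frac1i\sum_jx_j^i$: with $\sum_nq_n(t)z^n=e^{2\sum_{i\text{ odd}}t_iz^i}$ and $Q_{(r,s)}=q_rq_s+2\sum_{i=1}^s(-1)^iq_{r+i}q_{s-i}$, it is the Pfaffian of the skew-symmetric matrix with off-diagonal entries $Q_{(\lambda_i,\lambda_j)}$, where $\lambda$ is first extended by one part $0$ if its length is odd. For $k\ge0$ put $\tau_k(t)=s_{(k,k-1,\dots,2,1)}(t)$. **Proposition.** 1. A polynomial $\tau$ is a polynomial KdV tau-function if and only if $\tau(t)=a\,\tau_k(t+c)$ for some $k\ge0$, some constants $c=(c_1,c_2,c_3,\dots)$ and some $a\in\mathbb C\setminus\{0\}$. (In particular $\tau_k(t+c)=s_{(k,\dots,2,1)}(t_1+c_1,0,t_3+c_3,0,\dots)$, and only the $c_i$ with $i$ odd matter.) 2. For all $k\ge0$ and all $c$, the polynomial $\tau_k\!\left(\frac{t+c}2\right)$ is a BKP tau-function. 3. For every $k\ge0$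 there are nonzero constants $a,b$ such that for all $c$ $$\tau_k\!\left(\tfrac{t+c}2\right)=a\,Q_{(k,k-1,\dots,2,1)}\!\left(\tfrac{t+c}2\right),\qquad \tau_k\!\left(\tfrac{t+c}2\right)^2=b\,s_{(k^{k+1})}(t_1+c_1,0,t_3+c_3,0,\dots),$$ where $(k^{k+1})$ is the partition $(k,k,\dots,k)$ with $k+1$ parts. -/

import Mathlib

noncomputable section

namespace KdVBKP

open MvPolynomial

/-- The ring `ℂ[t₁, t₂, t₃, …]` of polynomials in the times; the variable `X i` is `t_i`. -/
abbrev TimePoly : Type := MvPolynomial ℕ+ ℂ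

/-- The power series `∑_{i ≥ 1} u_i z^i`. -/
def timeSeries {R : Type*} [CommRing R] (u : ℕ+ → R) : PowerSeries R :=
  PowerSeries.mk fun n => if h : 0 < n then u ⟨n, h⟩ else 0

/-- The series `timeSeries u` has no constant term, so it may be substituted into a power series. -/
theorem hasSubst_timeSeries {R : Type*} [CommRing R] (u : ℕ+ → R) :
    PowerSeries.HasSubst (timeSeries u) :=
  PowerSeries.HasSubst.of_constantCoeff_zero' (by simp [timeSeries])

/-- The power series `exp (∑_{i ≥ 1} u_i z^i)`. -/
def expTimes {R : Type*} [CommRing R] [Algebra ℚ R] (u : ℕ+ → R) : PowerSeries R :=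
  (PowerSeries.exp R).subst (timeSeries u)

/-- Keep the odd-numbered entries of a sequence of times and set the even-numbered ones to `0`. -/
def oddOnly {R : Type*} [Zero R] (u : ℕ+ → R) : ℕ+ → R :=
  fun i => if Odd (i : ℕ) then u i else 0

/-! ### Tau-functions -/

/-- `τ` does not depend on the even times `t₂, t₄, …`. -/
def IndepOfEven (τ : TimePoly) : Prop := ∀ i ∈ τ.vars, Odd (i : ℕ)

/-- `[z⁻¹] = (z⁻¹, z⁻²/2, z⁻³/3, …)`. -/
def zInv : ℕ+ → LaurentSeries ℂ :=
  fun i => HahnSeries.single (-(i : ℤ)) (1 / (i : ℂ))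

/-- `τ (t + a • u)`, where `t` is a sequence of numbers, `a` a number and `u` a sequence of
Laurent series in `z`. -/
def evalShift (τ : TimePoly) (t : ℕ+ → ℂ) (a : ℂ) (u : ℕ+ → LaurentSeries ℂ) :
    LaurentSeries ℂ :=
  MvPolynomial.eval₂ HahnSeries.C (fun i => HahnSeries.C (t i) + HahnSeries.C a * u i) τ

/-- `τ` is a polynomial tau-function of the KP hierarchy: `τ ≠ 0` and
`Res τ(t - [z⁻¹]) τ(y + [z⁻¹]) exp (∑_{i ≥ 1} (t_i - y_i) z^i) dz = 0` for all times `t`, `y`. -/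
def IsKPTau (τ : TimePoly) : Prop :=
  τ ≠ 0 ∧ ∀ t y : ℕ+ → ℂ,
    HahnSeries.coeff
      (evalShift τ t (-1) zInv * evalShift τ y 1 zInv *
        ((expTimes (t - y) : PowerSeries ℂ) : LaurentSeries ℂ)) (-1) = 0

/-- A polynomial KdV tau-function: a polynomial KP tau-function independent of the even times. -/
def IsKdVTau (τ : TimePoly) : Prop := IsKPTau τ ∧ IndepOfEven τ

/-- `τ` is a polynomial tau-function of the BKP hierarchy: a nonzero polynomial in the odd times
`t₁, t₃, t₅, …` such that
`Res τ(t - 2[z⁻¹]_odd) τ(y + 2[z⁻¹]_odd) exp (∑_{i odd} (t_i - y_i) z^i) dz/z = τ(t) τ(y)`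
for all times `t`, `y`, where `[z⁻¹]_odd = (z⁻¹, z⁻³/3, …)`. -/
def IsBKPTau (τ : TimePoly) : Prop :=
  τ ≠ 0 ∧ IndepOfEven τ ∧ ∀ t y : ℕ+ → ℂ,
    HahnSeries.coeff
      (evalShift τ t (-2) (oddOnly zInv) * evalShift τ y 2 (oddOnly zInv) *
        ((expTimes (oddOnly (t - y)) : PowerSeries ℂ) : LaurentSeries ℂ)) 0
      = MvPolynomial.eval t τ * MvPolynomial.eval y τ

/-! ### Schur functions -/

/-- The elementary Schur polynomials `s_n(t)`, with
`exp (∑_{i ≥ 1} t_i z^i) = ∑_{n ≥ 0} s_n(t) z^n`, and `s_n = 0` for `n < 0`. -/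
def elemSchur (n : ℤ) : TimePoly :=
  if 0 ≤ n then PowerSeries.coeff n.toNat (expTimes (fun i => (X i : TimePoly))) else 0

/-- The Schur function `s_λ(t) = det (s_{λ_i - i + j}(t))` of the partition
`λ = (λ_1, …, λ_n)`. -/
def schurFn {n : ℕ} (lam : Fin n → ℕ) : TimePoly :=
  Matrix.det (Matrix.of fun i j : Fin n =>
    elemSchur ((lam i : ℤ) - ((i : ℕ) : ℤ) + ((j : ℕ) : ℤ)))

/-- The partition `(k, k-1, …, 2, 1)`. -/
def staircase (k : ℕ) : Fin k → ℕ := fun i => k - (i : ℕ)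

/-- The partition `(k, k, …, k)` with `k + 1` parts. -/
def rectangle (k : ℕ) : Fin (k + 1) → ℕ := fun _ => k

/-! ### Schur Q-functions -/

/-- The Pfaffian of a skew-symmetric matrix of size `2m`:
`(1 / (2^m m!)) ∑_σ sgn(σ) ∏_{i=1}^m A_{σ(2i-1), σ(2i)}`. -/
def pfaffian {R : Type*} [CommRing R] [Algebra ℚ R] {m : ℕ}
    (A : Matrix (Fin (2 * m)) (Fin (2 * m)) R) : R :=
  algebraMap ℚ R (1 / (2 ^ m * (Nat.factorial m : ℚ))) *
    ∑ σ : Equiv.Perm (Fin (2 * m)), ((Equiv.Perm.sign σ : ℤ) : R) *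
      ∏ i : Fin m, A (σ ⟨2 * (i : ℕ), by omega⟩) (σ ⟨2 * (i : ℕ) + 1, by omega⟩)

/-- The one-row Q-functions `q_n`, with `∑_n q_n(t) z^n = exp (2 ∑_{i odd} t_i z^i)`. In terms of
`t_i = (1/i) ∑_j x_j^i` this generating series is `∏_j (1 + x_j z) / (1 - x_j z)`. -/
def qRow (n : ℕ) : TimePoly :=
  PowerSeries.coeff n (expTimes (oddOnly fun i => 2 * (X i : TimePoly)))

/-- The two-row Q-functions
`Q_{(r,s)} = q_r q_s + 2 ∑_{i=1}^s (-1)^i q_{r+i} q_{s-i}`. -/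
def qPair (r s : ℕ) : TimePoly :=
  qRow r * qRow s + 2 * ∑ i ∈ Finset.Icc 1 s, (-1) ^ i * (qRow (r + i) * qRow (s - i))

/-- The Schur Q-function `Q_λ(t)`, `t_i = (1/i) ∑_j x_j^i`, of a strict partition
`λ = (λ_1 > … > λ_n > 0)`: the Pfaffian of the skew-symmetric matrix with the entries
`Q_{(λ_i, λ_j)}` off the diagonal, where `λ` is first extended by a part `0` if `n` is odd. -/
def schurQ {n : ℕ} (lam : Fin n → ℕ) : TimePoly :=
  let ext : Fin (2 * ((n + 1) / 2)) → ℕ := fun i => if h : (i : ℕ) < n then lam ⟨i, h⟩ else 0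
  pfaffian (m := (n + 1) / 2)
    (Matrix.of fun i j => if i = j then 0 else qPair (ext i) (ext j))

/-! ### Substitutions of the times -/

/-- `p (t + c)`. -/
def shift (c : ℕ+ → ℂ) (p : TimePoly) : TimePoly :=
  MvPolynomial.aeval (fun i => (X i : TimePoly) + C (c i)) p

/-- `p ((t + c) / 2)`. -/
def halfShift (c : ℕ+ → ℂ) (p : TimePoly) : TimePoly :=
  MvPolynomial.aeval (fun i => C (1 / 2 : ℂ) * ((X i : TimePoly) + C (c i))) p

/-- `p (t₁ + c₁, 0, t₃ + c₃, 0, …)`. -/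
def oddShift (c : ℕ+ → ℂ) (p : TimePoly) : TimePoly :=
  MvPolynomial.aeval (oddOnly fun i => (X i : TimePoly) + C (c i)) p

/-- `τ_k(t) = s_{(k, k-1, …, 2, 1)}(t)`. -/
def kdvTau (k : ℕ) : TimePoly := schurFn (staircase k)

end KdVBKP

end

noncomputable section

namespace KdVBKP

/-! ### Exponentials of time series -/

section ExpTimes

open PowerSeries

variable {R S : Type*} [CommRing R] [CommRing S]

/-! Let F = exp(∑ t_i z^i) = ∑ h_n z^n. The staircase function τ_k is `stairDet F k`, the
determinant of the h_{k-2i+j}. Consecutive rows are shifted by 2, so multiplying F by an even series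
with constant term 1 is a unitriangular row operation; hence τ_k does not see the even times
(`stairDet_mul_even`).

KdV. Translating by -[z⁻¹] multiplies the generating series by a linear factor, and the coefficient
of z^p in the wave function of τ_k becomes the determinant with first row h_{p+j} above the rows
h_{k-1-2i+j}. It vanishes for p < -k and, by equality of rows, for p = k-1, k-3, …. So every wave
function lies in the space `InStairSpace k`, which is stable under z ↦ -z and isotropic for the
residue pairing; for τ independent of the even times the dual wave function is the wave function at
-z, and the bilinear identity follows. Conversely, moving the even times of a KdV tau-function
multiplies its dual wave function by even series. If z^(-k) is the lowest power that occurs in the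
dual wave functions, one of them is a z^(-k) exp(∑ b_i z^i), and translating τ by -b puts all its
wave functions into `InStairSpace k` (`IsKdVTau.exists_shift_inStairSpace`). Two tau-functions with
this property for the same k are orthogonal, hence proportional (`exists_eq_smul_of_residue`).

BKP and the rectangle. With odd times only, E = exp satisfies E(z)E(-z) = 1. Comparing E(z)² with
E(z)E(-z) writes the rows of the Hankel matrix of E² through the rows h_{k-1-2i+j} of E and one unit
vector (`zcoeff_sq`). Paired with the cofactors this leaves a gap in degrees 1, …, k of a wave
function at half times, so only the product of constant terms survives in the BKP residue. The
determinants give Hankel(E²) = const · τ_k² (`det_hankel_sq`), and the Hankel determinant is the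
rectangular Schur function up to sign.

Q-functions. The matrix (Q_{(r,s)}) for 0 ≤ r, s ≤ k is the same Hankel matrix times a triangular
one. Apart from its corner entry 1 it is skew-symmetric, so its determinant is that of the matrix
whose Pfaffian is Q of the staircase. Thus Q² = const · τ_k², and Q = const · τ_k because
polynomials form a domain. -/

theorem coeff_timeSeries (u : ℕ+ → R) (i : ℕ+) : coeff (i : ℕ) (timeSeries u) = u i := by
  rw [timeSeries, coeff_mk, dif_pos i.pos]
  rfl

theorem coeff_succ_timeSeries (u : ℕ+ → R) (n : ℕ) :
    coeff (n + 1) (timeSeries u) = u n.succPNat := by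
  simp [timeSeries, Nat.succPNat]

theorem constantCoeff_timeSeries (u : ℕ+ → R) : constantCoeff (timeSeries u) = 0 := by
  simp [timeSeries]

theorem timeSeries_add (u v : ℕ+ → R) : timeSeries (u + v) = timeSeries u + timeSeries v := by
  ext n
  cases n with
  | zero => simp [timeSeries]
  | succ n => simp only [map_add, coeff_succ_timeSeries, Pi.add_apply]

theorem map_timeSeries (f : R →+* S) (u : ℕ+ → R) :
    PowerSeries.map f (timeSeries u) = timeSeries fun i => f (u i) := by
  ext n
  simp only [timeSeries, coeff_mk, coeff_map]
  split_ifs <;> simp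

theorem derivative_map (f : R →+* S) (F : PowerSeries R) :
    derivative S (PowerSeries.map f F) = PowerSeries.map f (derivative R F) := by
  ext n
  simp [coeff_derivative]

theorem derivative_rescale_neg (F : PowerSeries R) :
    derivative R (rescale (-1) F) = -rescale (-1) (derivative R F) := by
  ext n
  simp [coeff_derivative, pow_succ]
  ring

theorem rescale_timeSeries (u : ℕ+ → R) :
    rescale (-1) (timeSeries u) = timeSeries fun i => (-1) ^ (i : ℕ) * u i := by
  ext n
  simp only [timeSeries, coeff_mk, coeff_rescale]
  split_ifs <;> simp

/-- The power series is invariant under `z ↦ -z`. -/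
def IsEvenSeries (F : PowerSeries R) : Prop := rescale (-1) F = F

theorem IsEvenSeries.coeff_odd [IsAddTorsionFree R]
    {F : PowerSeries R} (hF : IsEvenSeries F) {n : ℕ} (hn : Odd n) :
    coeff n F = 0 := by
  have h : coeff n (rescale (-1) F) = coeff n F := by rw [hF]
  rw [coeff_rescale, hn.neg_one_pow, neg_one_mul] at h
  exact self_eq_neg.1 h.symm

theorem mk_pow_mul_one_sub (w : R) : (mk fun n => w ^ n : PowerSeries R) * (1 - C w * X) = 1 := by
  ext n
  rw [mul_sub, mul_one, map_sub, coeff_mk, ← mul_assoc]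
  cases n with
  | zero => simp
  | succ n =>
    rw [coeff_succ_mul_X, mul_comm, coeff_C_mul, coeff_mk, coeff_one, if_neg (by omega)]
    ring

variable [Algebra ℚ R] [Algebra ℚ S]

theorem algebraMap_one_div_succ_mul (n : ℕ) :
    algebraMap ℚ R (1 / ((n + 1 : ℕ) : ℚ)) * ((n : R) + 1) = 1 := by
  have h2 : ((n : R) + 1) = algebraMap ℚ R ((n : ℚ) + 1) := by simp
  rw [h2, ← map_mul]
  have h3 : (n : ℚ) + 1 ≠ 0 := by positivity
  simp [h3]

theorem derivative_expTimes (u : ℕ+ → R) :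
    derivative R (expTimes u) = derivative R (timeSeries u) * expTimes u := by
  rw [expTimes, derivative_subst (hasSubst_timeSeries u), derivative_exp, mul_comm]

theorem constantCoeff_expTimes (u : ℕ+ → R) : constantCoeff (expTimes u) = 1 := by
  have h := constantCoeff_subst_eq_zero (S := R) (constantCoeff_timeSeries u) (exp R - 1) (by simp)
  rw [subst_sub (hasSubst_timeSeries u)] at h
  have h1 : subst (timeSeries u) (1 : PowerSeries R) = 1 := by
    rw [← coe_substAlgHom (hasSubst_timeSeries u), map_one]
  rw [h1] at h
  have h2 : constantCoeff (expTimes u - 1) = 0 := h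
  rw [map_sub, map_one, sub_eq_zero] at h2
  exact h2

/-- The quotient F/G has derivative zero and constant term 1. All identities between exponentials
below are checked through this differential equation. -/
theorem eq_of_derivative_eq_mul {F G D : PowerSeries R} (hF : derivative R F = D * F)
    (hG : derivative R G = D * G) (hF1 : constantCoeff F = 1) (hG1 : constantCoeff G = 1) :
    F = G := by
  have := IsAddTorsionFree.of_module_rat R
  obtain ⟨H, hH⟩ : ∃ H, G * H = 1 :=
    (isUnit_iff_constantCoeff.2 (by rw [hG1]; exact isUnit_one)).exists_right_inv
  have hH1 : constantCoeff H = 1 := by simpa [hG1] using congrArg constantCoeff hH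
  have hdH : derivative R H = -(D * H) := by
    have h := congrArg (derivative R) hH
    rw [Derivation.leibniz, hG, Derivation.map_one_eq_zero] at h
    simp only [smul_eq_mul] at h
    linear_combination H * h - (derivative R H + D * H) * hH
  have h : F * H = 1 := by
    refine derivative.ext ?_ (by simp [hF1, hH1])
    rw [Derivation.leibniz, hF, hdH, Derivation.map_one_eq_zero]
    simp only [smul_eq_mul]
    ring
  linear_combination G * h - F * hH

theorem eq_expTimes {F : PowerSeries R} {u : ℕ+ → R} (h1 : constantCoeff F = 1)
    (hF : derivative R F = derivative R (timeSeries u) * F) : F = expTimes u :=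
  eq_of_derivative_eq_mul hF (derivative_expTimes u) h1 (constantCoeff_expTimes u)

theorem expTimes_add (u v : ℕ+ → R) : expTimes (u + v) = expTimes u * expTimes v := by
  refine (eq_expTimes (by simp [constantCoeff_expTimes]) ?_).symm
  rw [Derivation.leibniz, derivative_expTimes, derivative_expTimes, timeSeries_add, map_add]
  simp only [smul_eq_mul]
  ring

theorem expTimes_zero : expTimes (0 : ℕ+ → R) = 1 := by
  refine (eq_expTimes (by simp) ?_).symm
  have : timeSeries (0 : ℕ+ → R) = 0 := by
    ext n
    cases n with
    | zero => simp [timeSeries]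
    | succ n => simp [coeff_succ_timeSeries]
  simp [this, Derivation.map_one_eq_zero]

theorem expTimes_mul_neg (u : ℕ+ → R) : expTimes u * expTimes (-u) = 1 := by
  rw [← expTimes_add, add_neg_cancel, expTimes_zero]

theorem map_expTimes (f : R →+* S) (u : ℕ+ → R) :
    PowerSeries.map f (expTimes u) = expTimes fun i => f (u i) := by
  refine eq_expTimes ?_ ?_
  · rw [← coeff_zero_eq_constantCoeff_apply, coeff_map, coeff_zero_eq_constantCoeff_apply,
      constantCoeff_expTimes, map_one]
  · rw [derivative_map, derivative_expTimes, map_mul, ← derivative_map, map_timeSeries]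

/-- The substitution `z ↦ -z` negates the odd times. -/
theorem rescale_expTimes (u : ℕ+ → R) :
    rescale (-1) (expTimes u) = expTimes fun i => (-1) ^ (i : ℕ) * u i := by
  refine eq_expTimes ?_ ?_
  · rw [← coeff_zero_eq_constantCoeff_apply, coeff_rescale, pow_zero, one_mul,
      coeff_zero_eq_constantCoeff_apply, constantCoeff_expTimes]
  · rw [derivative_rescale_neg, derivative_expTimes, map_mul, ← rescale_timeSeries,
      derivative_rescale_neg, neg_mul]

/-- `exp (-∑ (wz)^i / i) = 1 - wz`. -/
theorem expTimes_neg_pow_div (w : R) :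
    expTimes (fun i : ℕ+ => -(algebraMap ℚ R (1 / (i : ℚ)) * w ^ (i : ℕ))) = 1 - C w * X := by
  refine (eq_expTimes (by simp) ?_).symm
  have h : derivative R (timeSeries fun i : ℕ+ => -(algebraMap ℚ R (1 / (i : ℚ)) * w ^ (i : ℕ))) =
      -(C w * mk fun n => w ^ n) := by
    ext n
    rw [coeff_derivative, coeff_succ_timeSeries, map_neg, coeff_C_mul, coeff_mk]
    have := algebraMap_one_div_succ_mul (R := R) n
    rw [Nat.succPNat_coe, Nat.succ_eq_add_one] at *
    linear_combination (-w ^ (n + 1)) * this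
  rw [h, neg_mul, mul_assoc, mk_pow_mul_one_sub]
  simp [Derivation.map_one_eq_zero, Derivation.leibniz]

theorem mk_pow_eq_expTimes (w : R) :
    (mk fun n => w ^ n : PowerSeries R) =
      expTimes (fun i : ℕ+ => algebraMap ℚ R (1 / (i : ℚ)) * w ^ (i : ℕ)) := by
  have h3 := expTimes_mul_neg (fun i : ℕ+ => algebraMap ℚ R (1 / (i : ℚ)) * w ^ (i : ℕ))
  have h4 := expTimes_neg_pow_div w
  change expTimes (-fun i : ℕ+ => algebraMap ℚ R (1 / (i : ℚ)) * w ^ (i : ℕ)) = _ at h4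
  rw [h4] at h3
  linear_combination expTimes (fun i : ℕ+ => algebraMap ℚ R (1 / (i : ℚ)) * w ^ (i : ℕ)) *
      mk_pow_mul_one_sub w
    - (mk fun n => w ^ n : PowerSeries R) * h3

/-- Every power series with constant term `1` is the exponential of a time series. -/
theorem exists_expTimes_eq (F : PowerSeries R) (h1 : constantCoeff F = 1) :
    ∃ u : ℕ+ → R, expTimes u = F := by
  obtain ⟨H, hH⟩ : ∃ H, F * H = 1 :=
    (isUnit_iff_constantCoeff.2 (by rw [h1]; exact isUnit_one)).exists_right_inv
  -- The times are obtained by integrating the logarithmic derivative F'/F.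
  refine ⟨fun i => algebraMap ℚ R (1 / (i : ℚ)) * coeff ((i : ℕ) - 1) (derivative R F * H),
    (eq_expTimes h1 ?_).symm⟩
  have h : derivative R (timeSeries fun i : ℕ+ =>
      algebraMap ℚ R (1 / (i : ℚ)) * coeff ((i : ℕ) - 1) (derivative R F * H)) =
      derivative R F * H := by
    ext n
    rw [coeff_derivative, coeff_succ_timeSeries]
    have := algebraMap_one_div_succ_mul (R := R) n
    rw [Nat.succPNat_coe, Nat.succ_eq_add_one, Nat.add_sub_cancel] at *
    linear_combination (coeff n (derivative R F * H)) * this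
  rw [h]
  linear_combination (-derivative R F) * hH

theorem expTimes_injective {u v : ℕ+ → R} (h : expTimes u = expTimes v) : u = v := by
  have := IsAddTorsionFree.of_module_rat R
  have hd : derivative R (timeSeries u) = derivative R (timeSeries v) := by
    have h1 := derivative_expTimes u
    rw [h, derivative_expTimes v] at h1
    linear_combination (-expTimes (-v)) * h1 + (derivative R (timeSeries v) -
      derivative R (timeSeries u)) * expTimes_mul_neg v
  have ht : timeSeries u = timeSeries v :=
    derivative.ext hd (by rw [constantCoeff_timeSeries, constantCoeff_timeSeries])
  funext i
  rw [← coeff_timeSeries u, ht, coeff_timeSeries]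

theorem isEvenSeries_expTimes {u : ℕ+ → R} (hu : ∀ i : ℕ+, Odd (i : ℕ) → u i = 0) :
    IsEvenSeries (expTimes u) := by
  rw [IsEvenSeries, rescale_expTimes]
  congr 1
  funext i
  rcases Nat.even_or_odd (i : ℕ) with h | h
  · simp [h.neg_one_pow]
  · simp [hu i h]

theorem IsEvenSeries.exists_expTimes_eq {F : PowerSeries R} (hF : IsEvenSeries F)
    (h1 : constantCoeff F = 1) :
    ∃ u : ℕ+ → R, (∀ i : ℕ+, Odd (i : ℕ) → u i = 0) ∧ expTimes u = F := by
  have := IsAddTorsionFree.of_module_rat R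
  obtain ⟨u, hu⟩ := KdVBKP.exists_expTimes_eq F h1
  refine ⟨u, fun i hi => ?_, hu⟩
  have h : expTimes (fun i : ℕ+ => (-1) ^ (i : ℕ) * u i) = expTimes u := by
    rw [← rescale_expTimes, hu, hF]
  have h2 := congrFun (expTimes_injective h) i
  rw [hi.neg_one_pow, neg_one_mul] at h2
  exact self_eq_neg.1 h2.symm

theorem expTimes_oddOnly_mul_rescale (u : ℕ+ → R) :
    expTimes (oddOnly u) * rescale (-1) (expTimes (oddOnly u)) = 1 := by
  rw [rescale_expTimes, ← expTimes_add, ← expTimes_zero]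
  congr 1
  funext i
  rcases Nat.even_or_odd (i : ℕ) with h | h
  · simp [oddOnly, Nat.not_odd_iff_even.2 h]
  · simp [oddOnly, h, h.neg_one_pow]

end ExpTimes

/-! ### Staircase determinants -/

section Stair

open PowerSeries

variable {R S : Type*} [CommRing R] [CommRing S]

/-- The coefficient of `z ^ n` of a power series, for an integer `n`. -/
def zcoeff (F : PowerSeries R) (n : ℤ) : R := if 0 ≤ n then coeff n.toNat F else 0

theorem zcoeff_of_neg (F : PowerSeries R) {n : ℤ} (hn : n < 0) : zcoeff F n = 0 :=
  if_neg (by omega)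

@[simp] theorem zcoeff_natCast (F : PowerSeries R) (n : ℕ) : zcoeff F n = coeff n F := by
  simp [zcoeff]

theorem map_zcoeff (f : R →+* S) (F : PowerSeries R) (n : ℤ) :
    f (zcoeff F n) = zcoeff (PowerSeries.map f F) n := by
  simp only [zcoeff]
  split_ifs <;> simp

theorem zcoeff_mul (F G : PowerSeries R) {n : ℤ} {N : ℕ} (hN : n < N) :
    zcoeff (F * G) n = ∑ a ∈ Finset.range N, coeff a G * zcoeff F (n - a) := by
  rcases lt_or_ge n 0 with h | h
  · rw [zcoeff_of_neg _ h]
    refine (Finset.sum_eq_zero fun a _ => ?_).symm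
    rw [zcoeff_of_neg _ (by omega), mul_zero]
  · lift n to ℕ using h
    rw [zcoeff_natCast, mul_comm, coeff_mul, Finset.Nat.sum_antidiagonal_eq_sum_range_succ_mk]
    refine Finset.sum_subset_zero_on_sdiff (fun a => ?_) (fun a ha => ?_) (fun a ha => ?_)
    · simp only [Finset.mem_range]
      omega
    · simp only [Finset.mem_sdiff, Finset.mem_range] at ha
      rw [zcoeff_of_neg _ (by omega), mul_zero]
    · rw [Finset.mem_range] at ha
      have : (n : ℤ) - a = ((n - a : ℕ) : ℤ) := by omega
      rw [this, zcoeff_natCast]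

theorem zcoeff_mul_one_sub (F : PowerSeries R) (w : R) (n : ℤ) :
    zcoeff (F * (1 - C w * X)) n = zcoeff F n - w * zcoeff F (n - 1) := by
  rcases lt_trichotomy n 0 with h | rfl | h
  · rw [zcoeff_of_neg _ h, zcoeff_of_neg _ h, zcoeff_of_neg _ (by omega)]
    ring
  · simp [zcoeff]
  · obtain ⟨m, rfl⟩ : ∃ m : ℕ, n = ((m + 1 : ℕ) : ℤ) := ⟨(n - 1).toNat, by omega⟩
    have : ((m + 1 : ℕ) : ℤ) - 1 = (m : ℤ) := by push_cast; ring
    rw [this, zcoeff_natCast, zcoeff_natCast, zcoeff_natCast, mul_sub, mul_one, map_sub,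
      ← mul_assoc, coeff_succ_mul_X, mul_comm F, coeff_C_mul]

theorem sum_range_two_mul (f : ℕ → R) (N : ℕ) :
    ∑ a ∈ Finset.range (2 * N), f a = ∑ l ∈ Finset.range N, (f (2 * l) + f (2 * l + 1)) := by
  induction N with
  | zero => simp
  | succ N ih =>
    rw [show 2 * (N + 1) = 2 * N + 1 + 1 by ring, Finset.sum_range_succ, Finset.sum_range_succ, ih,
      Finset.sum_range_succ, add_assoc]

theorem zcoeff_mul_even (F : PowerSeries R) {G : PowerSeries R}
    (hG : ∀ n, Odd n → coeff n G = 0) {n : ℤ} {N : ℕ} (hN : n < 2 * N) :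
    zcoeff (F * G) n = ∑ l ∈ Finset.range N, coeff (2 * l) G * zcoeff F (n - 2 * l) := by
  rw [zcoeff_mul F G (N := 2 * N) (by push_cast; exact hN), sum_range_two_mul]
  refine Finset.sum_congr rfl fun l _ => ?_
  rw [hG (2 * l + 1) ⟨l, rfl⟩]
  push_cast
  ring

/-- The determinant `det (h_{λ_i - i + j})` for the staircase `λ = (k, k-1, …, 1)`, where the
`h_n` are the coefficients of `F`. -/
def stairDet (F : PowerSeries R) (k : ℕ) : R :=
  Matrix.det (Matrix.of fun i j : Fin k => zcoeff F ((k : ℤ) - 2 * (i : ℕ) + (j : ℕ)))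

/-- Lowering the index by 2l moves from row i to row i + l, so an even factor adds to each row
multiples of the rows below it. -/
theorem stairDet_mul_even (F : PowerSeries R) {G : PowerSeries R}
    (hG : ∀ n, Odd n → coeff n G = 0) (hG1 : constantCoeff G = 1) (k : ℕ) :
    stairDet (F * G) k = stairDet F k := by
  let L : Matrix (Fin k) (Fin k) R :=
    Matrix.of fun i i' => if (i : ℕ) ≤ i' then coeff (2 * ((i' : ℕ) - i)) G else 0
  have hL : L.det = 1 := by
    rw [Matrix.det_of_isUpperTriangular]
    · simp [L, hG1]
    · intro i j hij
      exact if_neg (not_le.2 hij)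
  rw [stairDet, stairDet, ← one_mul (Matrix.det (Matrix.of fun i j : Fin k => zcoeff F _)), ← hL,
    ← Matrix.det_mul]
  congr 1
  ext i j
  have hi := i.2
  have hj := j.2
  -- The cut-off k - i suffices: the row that would follow the last one has indices j - k < 0, so
  -- nothing is lost.
  rw [Matrix.of_apply, zcoeff_mul_even F hG (N := k - i) (by omega), Matrix.mul_apply]
  simp only [L, Matrix.of_apply]
  rw [Fin.sum_univ_eq_sum_range (fun a => (if (i : ℕ) ≤ a then coeff (2 * (a - i)) G else 0) *
      zcoeff F ((k : ℤ) - 2 * (a : ℕ) + (j : ℕ))) k,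
    ← Finset.sum_range_add_sum_Ico _ hi.le, Finset.sum_eq_zero (s := Finset.range (i : ℕ)),
    zero_add,
    Finset.sum_Ico_eq_sum_range]
  · refine Finset.sum_congr rfl fun l _ => ?_
    rw [if_pos (by omega), Nat.add_sub_cancel_left]
    congr 2
    push_cast
    ring
  · intro a ha
    rw [if_neg (by simpa using ha), zero_mul]

/-- The even times contribute an even factor with constant term 1. -/
theorem stairDet_expTimes_oddOnly [Algebra ℚ R] (u : ℕ+ → R) (k : ℕ) :
    stairDet (expTimes (oddOnly u)) k = stairDet (expTimes u) k := by
  have := IsAddTorsionFree.of_module_rat R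
  have hu : u = oddOnly u + (u - oddOnly u) := by abel
  have he : IsEvenSeries (expTimes (u - oddOnly u)) :=
    isEvenSeries_expTimes fun i hi => by simp [oddOnly, hi]
  conv_rhs => rw [hu, expTimes_add]
  rw [stairDet_mul_even _ (fun n hn => he.coeff_odd hn) (constantCoeff_expTimes _)]

/-- The matrix with first row `f` and the rows `(h_{m + j})_j` below it,
`m = k - 1, k - 3, …, 1 - k`. -/
def borderMatrix (F : PowerSeries R) (k : ℕ) (f : Fin (k + 1) → R) :
    Matrix (Fin (k + 1)) (Fin (k + 1)) R :=
  Matrix.of (Fin.cons f fun (i : Fin k) (j : Fin (k + 1)) =>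
    zcoeff F ((k : ℤ) - 1 - 2 * (i : ℕ) + (j : ℕ)))

@[simp] theorem borderMatrix_zero (F : PowerSeries R) (k : ℕ) (f : Fin (k + 1) → R)
    (j : Fin (k + 1)) : borderMatrix F k f 0 j = f j := rfl

@[simp] theorem borderMatrix_succ (F : PowerSeries R) (k : ℕ) (f : Fin (k + 1) → R)
    (i : Fin k) (j : Fin (k + 1)) :
    borderMatrix F k f i.succ j = zcoeff F ((k : ℤ) - 1 - 2 * (i : ℕ) + (j : ℕ)) := rfl

/-- The cofactors of the first row of `borderMatrix`. -/
def borderCofactor (F : PowerSeries R) (k : ℕ) (j : Fin (k + 1)) : R :=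
  (-1) ^ (j : ℕ) * Matrix.det (Matrix.of fun i l : Fin k =>
    zcoeff F ((k : ℤ) - 1 - 2 * (i : ℕ) + ((j.succAbove l : Fin (k + 1)) : ℕ)))

theorem det_borderMatrix (F : PowerSeries R) (k : ℕ) (f : Fin (k + 1) → R) :
    (borderMatrix F k f).det = ∑ j, f j * borderCofactor F k j := by
  rw [Matrix.det_succ_row_zero]
  refine Finset.sum_congr rfl fun j _ => ?_
  rw [borderMatrix_zero, mul_comm _ (f j), mul_assoc, borderCofactor]
  rfl

theorem map_borderCofactor (φ : R →+* S) (F : PowerSeries R) (k : ℕ) (j : Fin (k + 1)) :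
    φ (borderCofactor F k j) = borderCofactor (PowerSeries.map φ F) k j := by
  rw [borderCofactor, map_mul, map_pow, map_neg, map_one, RingHom.map_det, borderCofactor]
  congr 2
  ext i l
  simp [map_zcoeff]

theorem borderCofactor_zero (F : PowerSeries R) (k : ℕ) : borderCofactor F k 0 = stairDet F k := by
  rw [borderCofactor, stairDet, Fin.val_zero, pow_zero, one_mul]
  congr 1
  ext i l
  rw [Matrix.of_apply, Matrix.of_apply, Fin.zero_succAbove, Fin.val_succ]
  congr 1
  push_cast
  ring

theorem sum_row_mul_borderCofactor (F : PowerSeries R) (k : ℕ) (i : Fin k) :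
    ∑ j : Fin (k + 1), zcoeff F ((k : ℤ) - 1 - 2 * (i : ℕ) + (j : ℕ)) * borderCofactor F k j =
      0 := by
  rw [← det_borderMatrix]
  exact Matrix.det_zero_of_row_eq (Fin.succ_ne_zero i).symm (by ext j; simp)

/-- Expansion of `det (h_{m_i + j} - w h_{m_i + j - 1})` in powers of `w`. -/
theorem stairDet_mul_one_sub (F : PowerSeries R) (w : R) (k : ℕ) :
    stairDet (F * (1 - C w * X)) k = ∑ j : Fin (k + 1), w ^ (j : ℕ) * borderCofactor F k j := by
  -- Subtracting w times the preceding column turns the border 1, w, …, w^k into a unit vector and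
  -- every entry below into a coefficient of F(1 - wz), apart from column 0.
  rw [← det_borderMatrix F k fun j => w ^ (j : ℕ),
    Matrix.det_eq_of_forall_col_eq_smul_add_pred (B := Matrix.of
      (Fin.cons (Fin.cons 1 0) fun i : Fin k => Fin.cons (zcoeff F ((k : ℤ) - 1 - 2 * (i : ℕ)))
        fun j : Fin k => zcoeff (F * (1 - C w * X)) ((k : ℤ) - 2 * (i : ℕ) + (j : ℕ))))
      (fun _ => w), Matrix.det_succ_row_zero, Fin.sum_univ_succ]
  · simp [stairDet]
    rfl
  · intro i
    refine Fin.cases ?_ (fun i => ?_) i <;> simp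
  · intro i j
    refine Fin.cases ?_ (fun i => ?_) i
    · simp [pow_succ']
    · simp only [borderMatrix_succ, Matrix.of_apply, Fin.cons_succ, zcoeff_mul_one_sub,
        Fin.val_succ, Fin.val_castSucc]
      rw [show (k : ℤ) - 1 - 2 * (i : ℕ) + ((j : ℕ) + 1 : ℕ) = k - 2 * (i : ℕ) + (j : ℕ) by
        push_cast; ring, show (k : ℤ) - 2 * (i : ℕ) + (j : ℕ) - 1 = k - 1 - 2 * (i : ℕ) + (j : ℕ) by
        ring]
      ring

/-- After the last column is deleted, the bottom row is 0, …, 0, h_0 with h_0 = 1; expanding along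
it leaves a smaller staircase. -/
theorem borderCofactor_last (F : PowerSeries R) (hF : constantCoeff F = 1) (k : ℕ) :
    borderCofactor F (k + 1) (Fin.last (k + 1)) = (-1) ^ (k + 1) * stairDet F k := by
  rw [borderCofactor, Fin.val_last]
  congr 1
  rw [Matrix.det_succ_row _ (Fin.last k), Finset.sum_eq_single (Fin.last k)]
  · have h0 : zcoeff F 0 = 1 := by simpa [hF] using zcoeff_natCast F 0
    simp only [Matrix.of_apply, Fin.val_last, ← two_mul, pow_mul, Fin.succAbove_last,
      Fin.val_castSucc]
    rw [show ((k + 1 : ℕ) : ℤ) - 1 - 2 * (k : ℕ) + (k : ℕ) = 0 by push_cast; ring, h0]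
    simp only [neg_one_sq, one_pow, one_mul, stairDet]
    congr 1
    ext i j
    simp only [Matrix.submatrix_apply, Matrix.of_apply, Fin.val_castSucc]
    congr 1
    push_cast
    ring
  · intro j _ hj
    have : (j : ℕ) < k := Fin.val_lt_last hj
    rw [Matrix.of_apply, zcoeff_of_neg, mul_zero, zero_mul]
    simp only [Fin.succAbove_last, Fin.val_castSucc, Fin.val_last]
    push_cast
    omega
  · simp

end Stair

/-! ### Specialising the times in staircase Schur functions -/

theorem map_elemSchur {S : Type*} [CommRing S] [Algebra ℚ S] (f : TimePoly →+* S) (n : ℤ) :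
    f (elemSchur n) = zcoeff (expTimes fun i => f (MvPolynomial.X i)) n := by
  rw [← map_expTimes, ← map_zcoeff]
  rfl

/-- Any substitution of the times only changes the exponential series whose coefficients fill the
determinant. -/
theorem map_kdvTau {S : Type*} [CommRing S] [Algebra ℚ S] (f : TimePoly →+* S) (k : ℕ) :
    f (kdvTau k) = stairDet (expTimes fun i => f (MvPolynomial.X i)) k := by
  rw [kdvTau, schurFn, RingHom.map_det, stairDet]
  congr 1
  ext i j
  simp only [RingHom.mapMatrix_apply, Matrix.map_apply, Matrix.of_apply, map_elemSchur]
  congr 1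
  have := i.2
  simp only [staircase]
  omega

theorem kdvTau_eq (k : ℕ) :
    kdvTau k = stairDet (expTimes fun i => (MvPolynomial.X i : TimePoly)) k :=
  map_kdvTau (RingHom.id _) k

theorem IndepOfEven.bind₁ {p : TimePoly} (hp : IndepOfEven p) {f : ℕ+ → TimePoly}
    (hf : ∀ i : ℕ+, Odd (i : ℕ) → IndepOfEven (f i)) : IndepOfEven (MvPolynomial.bind₁ f p) := by
  intro i hi
  obtain ⟨j, hj, hij⟩ := MvPolynomial.mem_vars_bind₁ f p hi
  exact hf j (hp j hj) i hij

theorem indepOfEven_X {i : ℕ+} (hi : Odd (i : ℕ)) : IndepOfEven (MvPolynomial.X i) := by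
  intro j hj
  rw [MvPolynomial.vars_X, Finset.mem_singleton] at hj
  rwa [hj]

theorem indepOfEven_C (c : ℂ) : IndepOfEven (MvPolynomial.C c) := by
  intro j hj
  simp at hj

theorem IndepOfEven.add {p q : TimePoly} (hp : IndepOfEven p) (hq : IndepOfEven q) :
    IndepOfEven (p + q) := fun i hi =>
  (Finset.mem_union.1 (MvPolynomial.vars_add_subset p q hi)).elim (hp i) (hq i)

theorem IndepOfEven.mul {p q : TimePoly} (hp : IndepOfEven p) (hq : IndepOfEven q) :
    IndepOfEven (p * q) := fun i hi =>
  (Finset.mem_union.1 (MvPolynomial.vars_mul p q hi)).elim (hp i) (hq i)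

theorem indepOfEven_kdvTau (k : ℕ) : IndepOfEven (kdvTau k) := by
  have h : kdvTau k =
      MvPolynomial.bind₁ (oddOnly fun i => (MvPolynomial.X i : TimePoly)) (kdvTau k) := by
    have h2 := map_kdvTau
      (MvPolynomial.bind₁ (oddOnly fun i => (MvPolynomial.X i : TimePoly))).toRingHom k
    simp only [AlgHom.toRingHom_eq_coe, RingHom.coe_coe, MvPolynomial.bind₁_X_right] at h2
    rw [h2, stairDet_expTimes_oddOnly, kdvTau_eq]
  rw [h]
  intro i hi
  obtain ⟨j, -, hij⟩ := MvPolynomial.mem_vars_bind₁ _ _ hi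
  by_cases hj : Odd (j : ℕ)
  · rw [oddOnly, if_pos hj] at hij
    exact indepOfEven_X hj i hij
  · rw [oddOnly, if_neg hj] at hij
    simp at hij

/-! ### Laurent series and shifted tau-functions -/

theorem coeff_ofPowerSeries (F : PowerSeries ℂ) (p : ℤ) :
    HahnSeries.coeff (F : LaurentSeries ℂ) p = zcoeff F p := by
  rw [PowerSeries.coeff_coe, zcoeff]
  split_ifs with h1 h2 h2
  · omega
  · rfl
  · rw [show p.natAbs = p.toNat by omega]
  · omega

/-- Multiplication by a power series does not create terms of lower order. -/
theorem coeff_mul_ofPowerSeries_eq_zero {f : LaurentSeries ℂ} {m : ℤ}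
    (hf : ∀ p < m, HahnSeries.coeff f p = 0) (F : PowerSeries ℂ) {p : ℤ} (hp : p < m) :
    HahnSeries.coeff (f * (F : LaurentSeries ℂ)) p = 0 := by
  rw [HahnSeries.coeff_mul]
  refine Finset.sum_eq_zero fun ij hij => ?_
  rw [Finset.mem_antidiagonal] at hij
  rcases lt_or_ge ij.1 m with h | h
  · rw [hf _ h, zero_mul]
  · rw [coeff_ofPowerSeries, zcoeff_of_neg _ (by omega), mul_zero]

/-- The underlying function of `negZ`. -/
def negZFun (f : LaurentSeries ℂ) : LaurentSeries ℂ :=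
  ⟨fun p => (-1 : ℂ) ^ p * f.coeff p, f.isPWO_support.mono fun p hp => by
    rw [Function.mem_support] at hp
    exact right_ne_zero_of_mul hp⟩

theorem coeff_negZFun (f : LaurentSeries ℂ) (p : ℤ) :
    (negZFun f).coeff p = (-1 : ℂ) ^ p * f.coeff p := rfl

theorem mem_support_negZFun (f : LaurentSeries ℂ) (p : ℤ) :
    p ∈ (negZFun f).support ↔ p ∈ f.support := by
  rw [HahnSeries.mem_support, HahnSeries.mem_support, coeff_negZFun, mul_ne_zero_iff,
    and_iff_right (zpow_ne_zero p (by norm_num))]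

/-- The substitution `z ↦ -z` of Laurent series. -/
def negZ : LaurentSeries ℂ →+* LaurentSeries ℂ where
  toFun := negZFun
  map_one' := by
    ext p
    rw [coeff_negZFun, HahnSeries.coeff_one]
    split_ifs with h <;> simp [h]
  map_zero' := by
    ext p
    rw [coeff_negZFun, HahnSeries.coeff_zero, mul_zero]
  map_add' f g := by
    ext p
    rw [HahnSeries.coeff_add, coeff_negZFun, HahnSeries.coeff_add, mul_add]
    rfl
  map_mul' f g := by
    ext p
    rw [coeff_negZFun, HahnSeries.coeff_mul, HahnSeries.coeff_mul, Finset.mul_sum]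
    refine Finset.sum_congr (Finset.ext fun ij => ?_) fun ij hij => ?_
    · simp only [Finset.mem_antidiagonal, mem_support_negZFun]
    · rw [Finset.mem_antidiagonal] at hij
      rw [coeff_negZFun, coeff_negZFun, ← hij.2.2, zpow_add₀ (by norm_num)]
      ring

@[simp] theorem coeff_negZ (f : LaurentSeries ℂ) (p : ℤ) :
    (negZ f).coeff p = (-1 : ℂ) ^ p * f.coeff p := rfl

theorem negZ_ofPowerSeries (F : PowerSeries ℂ) :
    negZ (F : LaurentSeries ℂ) = (PowerSeries.rescale (-1) F : PowerSeries ℂ) := by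
  ext p
  rw [coeff_negZ, coeff_ofPowerSeries, coeff_ofPowerSeries]
  rcases lt_or_ge p 0 with h | h
  · rw [zcoeff_of_neg _ h, zcoeff_of_neg _ h, mul_zero]
  · lift p to ℕ using h
    simp

theorem negZ_C (c : ℂ) : negZ (HahnSeries.C c) = HahnSeries.C c := by
  ext p
  rw [coeff_negZ, HahnSeries.C_apply]
  by_cases hp : p = 0
  · simp [hp]
  · simp [HahnSeries.coeff_single_of_ne hp]

theorem negZ_zInv (i : ℕ+) : negZ (zInv i) = HahnSeries.C ((-1) ^ (i : ℕ)) * zInv i := by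
  ext p
  rw [coeff_negZ, HahnSeries.C_mul_eq_smul, HahnSeries.coeff_smul, smul_eq_mul, zInv]
  by_cases hp : p = -(i : ℤ)
  · rw [hp, zpow_neg, zpow_natCast, ← inv_pow, inv_neg_one]
  · simp [HahnSeries.coeff_single_of_ne hp]

theorem evalShift_eq (τ : TimePoly) (t : ℕ+ → ℂ) (a : ℂ) (u : ℕ+ → LaurentSeries ℂ) :
    evalShift τ t a u =
      MvPolynomial.eval₂Hom HahnSeries.C (fun i => HahnSeries.C (t i) + HahnSeries.C a * u i) τ :=
  rfl

theorem IndepOfEven.eval₂Hom_congr {S : Type*} [CommRing S] {τ : TimePoly} (hτ : IndepOfEven τ)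
    (f : ℂ →+* S) {g g' : ℕ+ → S} (h : ∀ i : ℕ+, Odd (i : ℕ) → g i = g' i) :
    MvPolynomial.eval₂Hom f g τ = MvPolynomial.eval₂Hom f g' τ :=
  MvPolynomial.eval₂Hom_congr' rfl (fun i hi _ => h i (hτ i hi)) rfl

theorem evalShift_bind₁ (τ : TimePoly) (f : ℕ+ → TimePoly) (t : ℕ+ → ℂ) (a : ℂ)
    (u : ℕ+ → LaurentSeries ℂ) :
    evalShift (MvPolynomial.bind₁ f τ) t a u =
      MvPolynomial.eval₂Hom HahnSeries.C (fun i => evalShift (f i) t a u) τ := by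
  rw [evalShift_eq, MvPolynomial.eval₂Hom_bind₁]
  rfl

theorem evalShift_shift (τ : TimePoly) (c t : ℕ+ → ℂ) (a : ℂ) (u : ℕ+ → LaurentSeries ℂ) :
    evalShift (shift c τ) t a u = evalShift τ (t + c) a u := by
  have h : shift c τ = MvPolynomial.bind₁ (fun i => (MvPolynomial.X i : TimePoly) +
    MvPolynomial.C (c i)) τ := rfl
  rw [h, evalShift_bind₁, evalShift_eq]
  congr 2
  funext i
  simp only [evalShift_eq, map_add, MvPolynomial.eval₂Hom_X', MvPolynomial.eval₂Hom_C, Pi.add_apply]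
  ring

theorem IndepOfEven.evalShift_one {τ : TimePoly} (hτ : IndepOfEven τ) (y : ℕ+ → ℂ) :
    evalShift τ y 1 zInv = negZ (evalShift τ y (-1) zInv) := by
  rw [evalShift_eq, evalShift_eq, MvPolynomial.map_eval₂Hom]
  have h : negZ.comp HahnSeries.C = HahnSeries.C := RingHom.ext negZ_C
  rw [h]
  refine hτ.eval₂Hom_congr _ fun i hi => ?_
  rw [map_add, map_mul, negZ_C, negZ_C, negZ_zInv, hi.neg_one_pow, ← mul_assoc, ← map_mul,
    neg_one_mul, neg_neg]

/-- The wave function `τ(t - [z⁻¹]) exp (∑ t_i z^i)`. -/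
def wave (τ : TimePoly) (t : ℕ+ → ℂ) : LaurentSeries ℂ :=
  evalShift τ t (-1) zInv * ((expTimes t : PowerSeries ℂ) : LaurentSeries ℂ)

/-- The dual wave function `τ(t + [z⁻¹]) exp (-∑ t_i z^i)`. -/
def dualWave (τ : TimePoly) (t : ℕ+ → ℂ) : LaurentSeries ℂ :=
  evalShift τ t 1 zInv * ((expTimes (-t) : PowerSeries ℂ) : LaurentSeries ℂ)

theorem wave_mul_dualWave (τ σ : TimePoly) (t y : ℕ+ → ℂ) :
    wave τ t * dualWave σ y = evalShift τ t (-1) zInv * evalShift σ y 1 zInv *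
        ((expTimes (t - y) : PowerSeries ℂ) : LaurentSeries ℂ) := by
  rw [wave, dualWave, sub_eq_add_neg, expTimes_add, PowerSeries.coe_mul]
  ring

theorem wave_shift (τ : TimePoly) (c t : ℕ+ → ℂ) :
    wave (shift c τ) t = wave τ (t + c) * ((expTimes (-c) : PowerSeries ℂ) : LaurentSeries ℂ) := by
  rw [wave, wave, evalShift_shift, mul_assoc, ← PowerSeries.coe_mul, ← expTimes_add,
    add_neg_cancel_right]

/-- Negate the even times. -/
def evenNeg (t : ℕ+ → ℂ) : ℕ+ → ℂ := fun i => -((-1) ^ (i : ℕ) * t i)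

theorem evenNeg_odd (t : ℕ+ → ℂ) {i : ℕ+} (hi : Odd (i : ℕ)) : evenNeg t i = t i := by
  simp [evenNeg, hi.neg_one_pow]

theorem IndepOfEven.evalShift_congr {τ : TimePoly} (hτ : IndepOfEven τ) {t t' : ℕ+ → ℂ}
    (h : ∀ i : ℕ+, Odd (i : ℕ) → t i = t' i) (a : ℂ) (u : ℕ+ → LaurentSeries ℂ) :
    evalShift τ t a u = evalShift τ t' a u :=
  hτ.eval₂Hom_congr _ fun i hi => by rw [h i hi]

/-- Under z ↦ -z the odd entries of [z⁻¹] change sign, and τ ignores the even ones. The exponential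
does not ignore them, which is why the even times must be negated. -/
theorem IndepOfEven.dualWave_eq {τ : TimePoly} (hτ : IndepOfEven τ) (y : ℕ+ → ℂ) :
    dualWave τ y = negZ (wave τ (evenNeg y)) := by
  rw [dualWave, wave, map_mul, ← hτ.evalShift_one, negZ_ofPowerSeries, rescale_expTimes,
    hτ.evalShift_congr fun i hi => (evenNeg_odd y hi).symm]
  congr 4
  funext i
  rw [evenNeg, mul_neg, ← mul_assoc, ← mul_pow]
  simp

theorem evenNeg_evenNeg (t : ℕ+ → ℂ) : evenNeg (evenNeg t) = t := by
  funext i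
  rw [evenNeg, evenNeg, mul_neg, ← mul_assoc, ← mul_pow]
  simp

theorem algebraMap_rat_laurent (q : ℚ) :
    algebraMap ℚ (LaurentSeries ℂ) q = HahnSeries.C (q : ℂ) := by
  have h : algebraMap ℚ (LaurentSeries ℂ) =
      (HahnSeries.C : ℂ →+* LaurentSeries ℂ).comp (algebraMap ℚ ℂ) := RingHom.ext_rat _ _
  rw [h]
  simp

theorem zInv_eq (i : ℕ+) : zInv i = algebraMap ℚ (LaurentSeries ℂ) (1 / (i : ℚ)) *
    (HahnSeries.single (-1) 1 : LaurentSeries ℂ) ^ (i : ℕ) := by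
  rw [algebraMap_rat_laurent, HahnSeries.single_pow, HahnSeries.C_apply,
    HahnSeries.single_mul_single, zInv]
  simp

/-- `τ_k(t - [z⁻¹])`, in powers of `z⁻¹`. -/
theorem evalShift_kdvTau (k : ℕ) (t : ℕ+ → ℂ) :
    evalShift (kdvTau k) t (-1) zInv = ∑ j : Fin (k + 1),
      (HahnSeries.single (-(j : ℕ) : ℤ) (borderCofactor (expTimes t) k j) : LaurentSeries ℂ) := by
  -- Two variables are in play: z⁻¹ is a scalar in the Laurent series, and the generating series in
  -- `PowerSeries.X` acquires the factor 1 - z⁻¹X.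
  have h : (expTimes fun i : ℕ+ => HahnSeries.C (t i) + HahnSeries.C (-1) * zInv i) =
      PowerSeries.map HahnSeries.C (expTimes t) *
        (1 - PowerSeries.C (HahnSeries.single (-1) 1 : LaurentSeries ℂ) * PowerSeries.X) := by
    rw [map_expTimes, ← expTimes_neg_pow_div, ← expTimes_add]
    congr 1
    funext i
    rw [Pi.add_apply, ← zInv_eq]
    simp
  rw [evalShift_eq, map_kdvTau]
  simp only [MvPolynomial.eval₂Hom_X']
  rw [h, stairDet_mul_one_sub]
  refine Finset.sum_congr rfl fun j _ => ?_
  rw [← map_borderCofactor, HahnSeries.single_pow, HahnSeries.C_apply,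
    HahnSeries.single_mul_single]
  simp

theorem coeff_evalShift_kdvTau_mul (k : ℕ) (t : ℕ+ → ℂ) (F : PowerSeries ℂ) (p : ℤ) :
    HahnSeries.coeff (evalShift (kdvTau k) t (-1) zInv * (F : LaurentSeries ℂ)) p =
      ∑ j : Fin (k + 1), zcoeff F (p + (j : ℕ)) * borderCofactor (expTimes t) k j := by
  rw [evalShift_kdvTau, Finset.sum_mul, HahnSeries.coeff_sum]
  refine Finset.sum_congr rfl fun j _ => ?_
  rw [HahnSeries.coeff_single_mul, coeff_ofPowerSeries, sub_neg_eq_add, mul_comm]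

/-- The closed subspace of Laurent series spanned by `z^(-k) ℂ⟦z²⟧` and `z^k ℂ⟦z⟧`. -/
def InStairSpace (k : ℕ) (f : LaurentSeries ℂ) : Prop :=
  (∀ p : ℤ, p < -k → f.coeff p = 0) ∧ ∀ i : ℕ, f.coeff ((k : ℤ) - 1 - 2 * i) = 0

/-- The coefficient of z^p is a bordered determinant with first row h_{p+j}: this row is zero for p
< -k, and for p = k-1-2i with i < k it repeats a row below. -/
theorem inStairSpace_wave_kdvTau (k : ℕ) (t : ℕ+ → ℂ) : InStairSpace k (wave (kdvTau k) t) := by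
  have h : ∀ p : ℤ, p < -k → (wave (kdvTau k) t).coeff p = 0 := fun p hp => by
    rw [wave, coeff_evalShift_kdvTau_mul]
    refine Finset.sum_eq_zero fun j _ => ?_
    rw [zcoeff_of_neg _ (by omega), zero_mul]
  refine ⟨h, fun i => ?_⟩
  rcases lt_or_ge i k with hi | hi
  · rw [wave, coeff_evalShift_kdvTau_mul]
    exact sum_row_mul_borderCofactor _ _ ⟨i, hi⟩
  · exact h _ (by omega)

theorem InStairSpace.negZ {k : ℕ} {f : LaurentSeries ℂ} (hf : InStairSpace k f) :
    InStairSpace k (negZ f) :=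
  ⟨fun p hp => by rw [coeff_negZ, hf.1 p hp, mul_zero],
    fun i => by rw [coeff_negZ, hf.2 i, mul_zero]⟩

/-- If p + q = -1, one of p, q has the parity of k - 1. That coefficient vanishes if its exponent is
at most k - 1; otherwise the other exponent is below -k. -/
theorem InStairSpace.residue_mul {k : ℕ} {f g : LaurentSeries ℂ} (hf : InStairSpace k f)
    (hg : InStairSpace k g) : (f * g).coeff (-1) = 0 := by
  have key : ∀ {f g : LaurentSeries ℂ}, InStairSpace k f → InStairSpace k g → ∀ p q : ℤ,
      p + q = -1 → (∃ l : ℤ, p = k - 1 - 2 * l) → f.coeff p * g.coeff q = 0 := by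
    rintro f g hf hg p q hpq ⟨l, rfl⟩
    rcases lt_or_ge l 0 with h | h
    · rw [hg.1 q (by omega), mul_zero]
    · lift l to ℕ using h
      rw [hf.2 l, zero_mul]
  rw [HahnSeries.coeff_mul]
  refine Finset.sum_eq_zero fun ij hij => ?_
  rw [Finset.mem_antidiagonal] at hij
  have hs := hij.2.2
  rcases Int.even_or_odd (ij.1 - (k - 1)) with ⟨l, hl⟩ | ⟨l, hl⟩
  · exact key hf hg _ _ hs ⟨-l, by omega⟩
  · rw [mul_comm]
    exact key hg hf _ _ (by omega) ⟨l + k, by omega⟩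

/-- The lowest coefficient of the wave function of τ_{k+1}, at z^(-k-1), is ±τ_k. -/
theorem kdvTau_ne_zero (k : ℕ) : kdvTau k ≠ 0 := by
  induction k with
  | zero =>
    rw [kdvTau_eq, stairDet, Matrix.det_fin_zero]
    exact one_ne_zero
  | succ k ih =>
    intro h
    refine ih (MvPolynomial.funext fun t => ?_)
    have h1 : (wave (kdvTau (k + 1)) t).coeff (-(k + 1 : ℕ)) = 0 := by
      rw [wave, h, evalShift_eq, map_zero, zero_mul]
      rfl
    rw [wave, coeff_evalShift_kdvTau_mul, Finset.sum_eq_single (Fin.last (k + 1)), Fin.val_last,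
      neg_add_cancel, borderCofactor_last _ (constantCoeff_expTimes t)] at h1
    · have h0 : zcoeff (expTimes t) 0 = 1 := by
        simpa [constantCoeff_expTimes] using zcoeff_natCast (expTimes t) 0
      rw [h0, one_mul] at h1
      have h2 : stairDet (expTimes t) k = 0 :=
        (mul_eq_zero.1 h1).resolve_left (pow_ne_zero _ (by norm_num))
      have h3 := map_kdvTau (MvPolynomial.eval t) k
      simp only [MvPolynomial.eval_X] at h3
      rw [h3, h2, map_zero]
    · intro j _ hj
      have := Fin.val_lt_last hj
      rw [zcoeff_of_neg _ (by omega), zero_mul]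
    · simp

theorem isKdVTau_kdvTau (k : ℕ) : IsKdVTau (kdvTau k) := by
  refine ⟨⟨kdvTau_ne_zero k, fun t y => ?_⟩, indepOfEven_kdvTau k⟩
  rw [← wave_mul_dualWave, (indepOfEven_kdvTau k).dualWave_eq]
  exact (inStairSpace_wave_kdvTau k t).residue_mul (inStairSpace_wave_kdvTau k _).negZ

/-! ### Translations and scalar multiples of tau-functions -/

theorem shift_eq_bind₁ (c : ℕ+ → ℂ) (τ : TimePoly) : shift c τ =
    MvPolynomial.bind₁ (fun i => (MvPolynomial.X i : TimePoly) + MvPolynomial.C (c i)) τ := rfl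

theorem shift_shift (c d : ℕ+ → ℂ) (τ : TimePoly) : shift c (shift d τ) = shift (c + d) τ := by
  rw [shift_eq_bind₁, shift_eq_bind₁, shift_eq_bind₁, MvPolynomial.bind₁_bind₁]
  congr 2
  funext i
  simp only [map_add, MvPolynomial.bind₁_X_right, MvPolynomial.bind₁_C_right, Pi.add_apply]
  ring

theorem shift_zero (τ : TimePoly) : shift 0 τ = τ := by
  simp [shift]

theorem eval_shift (t c : ℕ+ → ℂ) (τ : TimePoly) :
    MvPolynomial.eval t (shift c τ) = MvPolynomial.eval (t + c) τ := by
  rw [shift_eq_bind₁, MvPolynomial.eval, MvPolynomial.eval₂Hom_bind₁]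
  congr 2
  funext i
  simp

theorem shift_ne_zero {τ : TimePoly} (hτ : τ ≠ 0) (c : ℕ+ → ℂ) : shift c τ ≠ 0 := by
  intro h
  have h2 := congrArg (shift (-c)) h
  rw [shift_shift, neg_add_cancel, shift_zero] at h2
  exact hτ (h2.trans (by simp [shift]))

theorem IndepOfEven.shift {τ : TimePoly} (hτ : IndepOfEven τ) (c : ℕ+ → ℂ) :
    IndepOfEven (shift c τ) := by
  rw [shift_eq_bind₁]
  exact hτ.bind₁ fun i hi => (indepOfEven_X hi).add (indepOfEven_C _)

theorem IsKdVTau.shift {τ : TimePoly} (hτ : IsKdVTau τ) (c : ℕ+ → ℂ) : IsKdVTau (shift c τ) := by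
  refine ⟨⟨shift_ne_zero hτ.1.1 c, fun t y => ?_⟩, hτ.2.shift c⟩
  rw [evalShift_shift, evalShift_shift, ← add_sub_add_right_eq_sub t y c]
  exact hτ.1.2 _ _

theorem IsKdVTau.smul {τ : TimePoly} (hτ : IsKdVTau τ) {a : ℂ} (ha : a ≠ 0) :
    IsKdVTau (a • τ) := by
  rw [MvPolynomial.smul_eq_C_mul]
  refine ⟨⟨mul_ne_zero (by simpa using ha) hτ.1.1, fun t y => ?_⟩, (indepOfEven_C a).mul hτ.2⟩
  have h : ∀ (t : ℕ+ → ℂ) (b : ℂ), evalShift (MvPolynomial.C a * τ) t b zInv =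
      HahnSeries.C a * evalShift τ t b zInv := fun t b => by
    rw [evalShift_eq, map_mul, MvPolynomial.eval₂Hom_C]
    rfl
  rw [h, h, show ∀ x y z w : LaurentSeries ℂ, x * y * (x * z) * w = x * (x * (y * z * w)) by
    intros; ring, HahnSeries.C_mul_eq_smul, HahnSeries.coeff_smul, HahnSeries.C_mul_eq_smul,
    HahnSeries.coeff_smul, hτ.1.2, smul_zero, smul_zero]

/-! ### Tau-functions with the same wave functions are proportional -/

/-- `[u] = (u, u²/2, u³/3, …)`. -/
def bracket (u : ℂ) : ℕ+ → ℂ := fun i => algebraMap ℚ ℂ (1 / (i : ℚ)) * u ^ (i : ℕ)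

/-- The polynomial `τ(t + a[x])` in `x`. -/
def bracketPoly (τ : TimePoly) (t : ℕ+ → ℂ) (a : ℂ) : Polynomial ℂ :=
  MvPolynomial.eval₂Hom Polynomial.C (fun i => Polynomial.C (t i) +
    Polynomial.C (a * algebraMap ℚ ℂ (1 / (i : ℚ))) * Polynomial.X ^ (i : ℕ)) τ

theorem eval_bracketPoly (τ : TimePoly) (t : ℕ+ → ℂ) (a x : ℂ) :
    (bracketPoly τ t a).eval x = MvPolynomial.eval (t + a • bracket x) τ := by
  rw [bracketPoly, ← Polynomial.coe_evalRingHom, MvPolynomial.map_eval₂Hom, MvPolynomial.eval]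
  congr 2
  · ext c
    simp
  · funext i
    simp [bracket, mul_assoc]

theorem evalShift_zInv_eq (τ : TimePoly) (t : ℕ+ → ℂ) (a : ℂ) :
    evalShift τ t a zInv =
      (bracketPoly τ t a).eval₂ HahnSeries.C (HahnSeries.single (-1) 1 : LaurentSeries ℂ) := by
  rw [bracketPoly, ← Polynomial.coe_eval₂RingHom, MvPolynomial.map_eval₂Hom, evalShift_eq]
  congr 2
  · ext1 c
    simp
  · funext i
    rw [zInv_eq, algebraMap_rat_laurent]
    simp [mul_assoc]

/-- For a monomial, Res z^(-l)/(1 - uz) dz is u^(l-1) if l ≥ 1 and 0 if l = 0; the latter accounts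
for the subtracted value at 0. -/
theorem residue_eval₂_mul_geom (P : Polynomial ℂ) (u : ℂ) :
    u * HahnSeries.coeff (P.eval₂ HahnSeries.C (HahnSeries.single (-1) 1 : LaurentSeries ℂ) *
      ((PowerSeries.mk fun n => u ^ n : PowerSeries ℂ) : LaurentSeries ℂ)) (-1) =
      P.eval u - P.eval 0 := by
  induction P using Polynomial.induction_on' with
  | add P Q hP hQ =>
    rw [Polynomial.eval₂_add, add_mul, HahnSeries.coeff_add, mul_add, hP, hQ, Polynomial.eval_add,
      Polynomial.eval_add]
    ring
  | monomial l c =>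
    rw [Polynomial.eval₂_monomial, HahnSeries.single_pow, HahnSeries.C_apply,
      HahnSeries.single_mul_single, HahnSeries.coeff_single_mul, coeff_ofPowerSeries,
      Polynomial.eval_monomial, Polynomial.eval_monomial]
    cases l with
    | zero =>
      rw [zcoeff_of_neg _ (by simp)]
      simp
    | succ l =>
      rw [show (-1 : ℤ) - (0 + (l + 1) • (-1)) = (l : ℤ) by simp, zcoeff_natCast,
        PowerSeries.coeff_mk]
      simp [pow_succ]
      ring

/-- The translation by `-v` acts on `τ` and `σ` by the same factor. -/
def SameFactor (τ σ : TimePoly) (v : ℕ+ → ℂ) : Prop :=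
  shift (-v) τ * σ = τ * shift (-v) σ

/-- Put y = t - [u]: the exponential becomes 1/(1 - uz), and the residue is the difference between x
= u and x = 0 of τ(t - [x]) σ(t - [u] + [x]). -/
theorem sameFactor_bracket {τ σ : TimePoly}
    (h : ∀ t y, (wave τ t * dualWave σ y).coeff (-1) = 0) (u : ℂ) :
    SameFactor τ σ (bracket u) := by
  refine MvPolynomial.funext fun t => ?_
  have h1 := h t (t - bracket u)
  have h2 := residue_eval₂_mul_geom
    (bracketPoly τ t (-1) * bracketPoly σ (t - bracket u) 1) u
  have h3 : (PowerSeries.mk fun n => u ^ n : PowerSeries ℂ) = expTimes (bracket u) :=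
    mk_pow_eq_expTimes u
  rw [wave_mul_dualWave, evalShift_zInv_eq, evalShift_zInv_eq, ← Polynomial.eval₂_mul,
    sub_sub_cancel, ← h3] at h1
  have h0 : bracket 0 = 0 := by
    funext i
    simp [bracket]
  rw [h1, mul_zero, Polynomial.eval_mul, Polynomial.eval_mul] at h2
  simp only [eval_bracketPoly, h0, smul_zero, add_zero, one_smul, sub_add_cancel, neg_smul,
    ← sub_eq_add_neg] at h2
  rw [map_mul, map_mul, eval_shift, eval_shift, ← sub_eq_add_neg]
  linear_combination -h2

/-- Equality of factors says that τ/σ is invariant under the translation, and invariances compose.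
-/
theorem SameFactor.add {τ σ : TimePoly} (hσ : σ ≠ 0) {v w : ℕ+ → ℂ} (hv : SameFactor τ σ v)
    (hw : SameFactor τ σ w) : SameFactor τ σ (v + w) := by
  have h := congrArg (shift (-v)) hw
  have hmul : ∀ p q : TimePoly, shift (-v) (p * q) = shift (-v) p * shift (-v) q :=
    fun p q => map_mul _ p q
  rw [hmul, hmul, shift_shift, shift_shift, ← neg_add] at h
  refine mul_right_cancel₀ (shift_ne_zero hσ (-v)) ?_
  unfold SameFactor at hv
  linear_combination σ * h + shift (-(v + w)) σ * hv

theorem sameFactor_zero (τ σ : TimePoly) : SameFactor τ σ 0 := by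
  rw [SameFactor, neg_zero, shift_zero, shift_zero]

theorem SameFactor.sum {τ σ : TimePoly} (hσ : σ ≠ 0) {v : ℕ → ℕ+ → ℂ}
    (hv : ∀ l, SameFactor τ σ (v l)) (n : ℕ) : SameFactor τ σ (∑ l ∈ Finset.range n, v l) := by
  induction n with
  | zero => exact sameFactor_zero τ σ
  | succ n ih =>
    rw [Finset.sum_range_succ]
    exact ih.add hσ (hv n)

theorem shift_eq_self {τ : TimePoly} {v : ℕ+ → ℂ} (h : ∀ i ∈ τ.vars, v i = 0) :
    shift v τ = τ := by
  refine MvPolynomial.funext fun t => ?_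
  rw [eval_shift]
  exact MvPolynomial.eval₂Hom_congr' rfl (fun i hi _ => by rw [Pi.add_apply, h i hi, add_zero]) rfl

/-- Power sums of the n-th roots of unity vanish in degrees 1, …, n - 1, so these sums of brackets
are triangular in the times. -/
theorem sum_bracket_rootsOfUnity {n : ℕ} {ζ : ℂ} (hζ : IsPrimitiveRoot ζ n) (u : ℂ) {i : ℕ+}
    (hi : (i : ℕ) < n) : (∑ l ∈ Finset.range n, bracket (ζ ^ l * u)) i = 0 := by
  have h1 : ζ ^ (i : ℕ) ≠ 1 := hζ.pow_ne_one_of_pos_of_lt i.pos.ne' hi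
  have h2 : ∑ l ∈ Finset.range n, (ζ ^ (i : ℕ)) ^ l = 0 := by
    have h3 := geom_sum_mul (ζ ^ (i : ℕ)) n
    rw [pow_right_comm, hζ.pow_eq_one, one_pow, sub_self] at h3
    exact (mul_eq_zero.1 h3).resolve_right (sub_ne_zero.2 h1)
  rw [Finset.sum_apply]
  simp only [bracket, mul_pow]
  rw [← Finset.mul_sum, ← Finset.sum_mul]
  simp only [← pow_mul] at h2 ⊢
  simp only [mul_comm _ (i : ℕ), h2, zero_mul, mul_zero]

/-- Only finitely many times occur in τ and σ. The entries of v up to the largest of them are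
removed one by one, from the lowest, by sums of brackets over roots of unity. -/
theorem sameFactor_of_bracket {τ σ : TimePoly} (hσ : σ ≠ 0)
    (h : ∀ u, SameFactor τ σ (bracket u)) (v : ℕ+ → ℂ) : SameFactor τ σ v := by
  obtain ⟨M, hM⟩ : ∃ M : ℕ, ∀ i ∈ τ.vars ∪ σ.vars, (i : ℕ) ≤ M :=
    ⟨(τ.vars ∪ σ.vars).sup fun i : ℕ+ => (i : ℕ),
      fun i hi => Finset.le_sup (f := fun i : ℕ+ => (i : ℕ)) hi⟩
  have key : ∀ (d : ℕ) (v : ℕ+ → ℂ), (∀ i : ℕ+, (i : ℕ) + d ≤ M → v i = 0) →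
      SameFactor τ σ v := by
    intro d
    induction d with
    | zero =>
      intro v hv
      have hv' : ∀ i ∈ τ.vars ∪ σ.vars, (-v) i = 0 := fun i hi => by
        rw [Pi.neg_apply, hv i (hM i hi), neg_zero]
      rw [SameFactor, shift_eq_self fun i hi => hv' i (Finset.mem_union_left _ hi),
        shift_eq_self fun i hi => hv' i (Finset.mem_union_right _ hi)]
    | succ d ih =>
      intro v hv
      rcases lt_or_ge d M with hd | hd
      -- The first entry that may be nonzero is the n-th. With u^n = v_n, the sum of the n brackets
      -- has n-th entry n · u^n / n = v_n.
      · obtain ⟨n, hn⟩ : ∃ n : ℕ+, (n : ℕ) = M - d := ⟨⟨M - d, by omega⟩, rfl⟩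
        obtain ⟨u, hu⟩ := IsAlgClosed.exists_pow_nat_eq (v n) n.pos
        have hζ := Complex.isPrimitiveRoot_exp n n.pos.ne'
        set ζ := Complex.exp (2 * Real.pi * Complex.I / (n : ℕ))
        have hs := SameFactor.sum hσ (fun l => h (ζ ^ l * u)) n
        rw [← sub_add_cancel v (∑ l ∈ Finset.range n, bracket (ζ ^ l * u))]
        refine SameFactor.add hσ (ih _ fun i hi => ?_) hs
        rw [Pi.sub_apply]
        rcases lt_or_ge (i : ℕ) n with hin | hin
        · rw [sum_bracket_rootsOfUnity hζ u hin, hv i (by omega), sub_zero]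
        · obtain rfl : i = n := PNat.coe_injective (by omega)
          rw [Finset.sum_apply, sub_eq_zero, ← hu]
          simp only [bracket, mul_pow, ← pow_mul]
          simp only [mul_comm _ (i : ℕ), pow_mul, hζ.pow_eq_one, one_pow, one_mul, Finset.sum_const,
            Finset.card_range]
          simp
      · exact ih v fun i hi => absurd i.pos (by omega)
  exact key M v fun i hi => absurd i.pos (by omega)

/-- The quotient τ/σ is invariant under all translations, hence constant. -/
theorem exists_eq_smul_of_residue {τ σ : TimePoly} (hτ : τ ≠ 0) (hσ : σ ≠ 0)
    (h : ∀ t y, (wave τ t * dualWave σ y).coeff (-1) = 0) : ∃ a : ℂ, a ≠ 0 ∧ τ = a • σ := by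
  have hv := sameFactor_of_bracket hσ (sameFactor_bracket h)
  obtain ⟨t₀, ht₀⟩ : ∃ t₀, MvPolynomial.eval t₀ σ ≠ 0 := by
    by_contra! h0
    exact hσ (MvPolynomial.funext fun t => by rw [h0 t, map_zero])
  have key : τ = (MvPolynomial.eval t₀ τ / MvPolynomial.eval t₀ σ) • σ := by
    refine MvPolynomial.funext fun t => ?_
    have h1 := congrArg (MvPolynomial.eval t) (hv (t - t₀))
    rw [map_mul, map_mul, eval_shift, eval_shift, ← sub_eq_add_neg, sub_sub_cancel] at h1
    rw [MvPolynomial.smul_eval, div_mul_eq_mul_div, h1, mul_div_cancel_right₀ _ ht₀]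
  refine ⟨_, fun h0 => hτ ?_, key⟩
  rw [key, h0, zero_smul]

/-! ### The polynomial KdV tau-functions -/

/-- The bound on the pole order is uniform in t, so a largest order over all t exists. -/
theorem exists_coeff_evalShift_eq_zero (τ : TimePoly) : ∃ N : ℕ, ∀ (t : ℕ+ → ℂ) (a : ℂ) (p : ℤ),
    p < -N → (evalShift τ t a zInv).coeff p = 0 := by
  induction τ using MvPolynomial.induction_on with
  | C c =>
    refine ⟨0, fun t a p hp => ?_⟩
    rw [evalShift_eq, MvPolynomial.eval₂Hom_C, HahnSeries.C_apply,
      HahnSeries.coeff_single_of_ne (by omega)]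
  | add τ σ hτ hσ =>
    obtain ⟨N, hN⟩ := hτ
    obtain ⟨M, hM⟩ := hσ
    refine ⟨N + M, fun t a p hp => ?_⟩
    push_cast at hp
    rw [evalShift_eq, map_add, ← evalShift_eq, ← evalShift_eq, HahnSeries.coeff_add,
      hN t a p (by omega), hM t a p (by omega), add_zero]
  | mul_X τ i hτ =>
    obtain ⟨N, hN⟩ := hτ
    refine ⟨N + i, fun t a p hp => ?_⟩
    push_cast at hp
    rw [evalShift_eq, map_mul, ← evalShift_eq, MvPolynomial.eval₂Hom_X', mul_add,
      HahnSeries.coeff_add, mul_comm, HahnSeries.C_mul_eq_smul, HahnSeries.coeff_smul,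
      hN t a p (by omega), zInv, mul_comm, HahnSeries.C_apply, HahnSeries.single_mul_single,
      HahnSeries.coeff_single_mul, hN t a _ (by omega)]
    simp

/-- If only positive powers of z occurred, they would also do so after removing the exponential; but
the constant term is then τ(t). -/
theorem exists_coeff_dualWave_ne_zero {τ : TimePoly} (hτ : τ ≠ 0) :
    ∃ (k : ℕ) (t : ℕ+ → ℂ), (dualWave τ t).coeff (-k) ≠ 0 := by
  obtain ⟨t, ht⟩ : ∃ t, MvPolynomial.eval t τ ≠ 0 := by
    by_contra! h0
    exact hτ (MvPolynomial.funext fun t => by rw [h0 t, map_zero])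
  by_contra! h
  have h1 : ∀ p : ℤ, p < 1 → (dualWave τ t).coeff p = 0 := fun p hp => by
    obtain ⟨k, rfl⟩ : ∃ k : ℕ, p = -k := ⟨(-p).toNat, by omega⟩
    exact h k t
  have h2 := coeff_mul_ofPowerSeries_eq_zero h1 (expTimes t) (p := 0) (by omega)
  rw [dualWave, mul_assoc, ← PowerSeries.coe_mul, mul_comm (expTimes _), expTimes_mul_neg,
    PowerSeries.coe_one, mul_one, evalShift_zInv_eq] at h2
  have h3 : ∀ P : Polynomial ℂ, HahnSeries.coeff (P.eval₂ HahnSeries.C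
      (HahnSeries.single (-1) 1 : LaurentSeries ℂ)) 0 = P.eval 0 := fun P => by
    induction P using Polynomial.induction_on' with
    | add P Q hP hQ => rw [Polynomial.eval₂_add, HahnSeries.coeff_add, hP, hQ, Polynomial.eval_add]
    | monomial l c =>
      rw [Polynomial.eval₂_monomial, HahnSeries.single_pow, HahnSeries.C_apply,
        HahnSeries.single_mul_single, Polynomial.eval_monomial]
      cases l with
      | zero => simp
      | succ l =>
        rw [HahnSeries.coeff_single_of_ne (by simp; omega)]
        simp
  rw [h3, eval_bracketPoly] at h2
  have h0 : bracket 0 = 0 := by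
    funext i
    simp [bracket]
  rw [h0, smul_zero, add_zero] at h2
  exact ht h2

theorem IsKdVTau.residue_wave_mul_even {τ : TimePoly} (hτ : IsKdVTau τ) (t y : ℕ+ → ℂ)
    (j : ℕ) : (wave τ t * dualWave τ y * HahnSeries.single (2 * j : ℤ) (1 : ℂ)).coeff (-1) = 0 := by
  have h0 : ∀ y, (wave τ t * dualWave τ y).coeff (-1) = 0 := fun y => by
    rw [wave_mul_dualWave]
    exact hτ.1.2 t y
  cases j with
  | zero =>
    rw [Nat.cast_zero, mul_zero, ← HahnSeries.C_apply, HahnSeries.C_one, mul_one]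
    exact h0 y
  | succ j =>
    -- Even times produce only even series with constant term 1, so z^(2j+2) is reached as (1 +
    -- z^(2j+2)) - 1.
    have he : IsEvenSeries (1 + PowerSeries.X ^ (2 * (j + 1)) : PowerSeries ℂ) := by
      rw [IsEvenSeries, map_add, map_one, map_pow, PowerSeries.rescale_X, mul_pow, ← map_pow,
        pow_mul (-1 : ℂ)]
      simp
    obtain ⟨u, hu, hu2⟩ := he.exists_expTimes_eq (by simp)
    have h1 : dualWave τ (y - u) =
        dualWave τ y * (1 + HahnSeries.single (2 * ((j + 1 : ℕ) : ℤ)) (1 : ℂ)) := by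
      rw [dualWave, dualWave, neg_sub, sub_eq_add_neg u, add_comm u, expTimes_add, hu2,
        PowerSeries.coe_mul, PowerSeries.coe_add, PowerSeries.coe_pow, PowerSeries.coe_X,
        PowerSeries.coe_one, HahnSeries.single_pow, mul_assoc,
        hτ.2.evalShift_congr (t := y - u) (t' := y) fun i hi => by simp [hu i hi]]
      simp
    have h2 := h0 (y - u)
    rw [h1, mul_add, mul_one, mul_add, HahnSeries.coeff_add, h0 y, zero_add, ← mul_assoc] at h2
    exact h2

/-- A single dual wave function of maximal pole order k fixes the translation; its orthogonality,
times even powers of z, to all wave functions yields the vanishing at k - 1 - 2j. -/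
theorem IsKdVTau.exists_shift_inStairSpace {τ : TimePoly} (hτ : IsKdVTau τ) :
    ∃ (k : ℕ) (c : ℕ+ → ℂ), ∀ t, InStairSpace k (wave (KdVBKP.shift c τ) t) := by
  classical
  obtain ⟨N, hN⟩ := exists_coeff_evalShift_eq_zero τ
  let P : ℕ → Prop := fun k => ∃ t : ℕ+ → ℂ, (dualWave τ t).coeff (-k) ≠ 0
  have hPN : ∀ k, P k → k ≤ N := by
    rintro k ⟨t, ht⟩
    by_contra! hk
    exact ht (coeff_mul_ofPowerSeries_eq_zero (m := -N) (hN t 1) _ (by omega))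
  obtain ⟨k₀, hk₀⟩ : ∃ k, P k := exists_coeff_dualWave_ne_zero hτ.1.1
  have hk := Nat.findGreatest_spec (hPN k₀ hk₀) hk₀
  have hmax : ∀ l, P l → l ≤ Nat.findGreatest P N := fun l hl => Nat.le_findGreatest (hPN l hl) hl
  set k := Nat.findGreatest P N
  obtain ⟨y, hy⟩ := hk
  have hlow : ∀ (t : ℕ+ → ℂ) (p : ℤ), p < -k → (dualWave τ t).coeff p = 0 := by
    intro t p hp
    by_contra hne
    have := hmax p.natAbs ⟨t, by rwa [show -(p.natAbs : ℤ) = p by omega]⟩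
    omega
  have hlow' : ∀ (t : ℕ+ → ℂ) (p : ℤ), p < -k → (wave τ t).coeff p = 0 := by
    intro t p hp
    have h := hlow (evenNeg t) p hp
    rw [hτ.2.dualWave_eq, evenNeg_evenNeg, coeff_negZ] at h
    exact (mul_eq_zero.1 h).resolve_left (zpow_ne_zero _ (by norm_num))
  set a := (dualWave τ y).coeff (-k)
  -- Normalised to constant term 1, the leading dual wave function is an exponential with times b;
  -- translating τ by -b multiplies the wave functions by exactly this exponential.
  let F : PowerSeries ℂ := PowerSeries.mk fun n => a⁻¹ * (dualWave τ y).coeff (n - k)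
  obtain ⟨b, hb⟩ := exists_expTimes_eq F (by simp [F, a, hy])
  have hF : dualWave τ y = HahnSeries.single (-k : ℤ) a * (F : LaurentSeries ℂ) := by
    ext p
    rw [HahnSeries.coeff_single_mul, coeff_ofPowerSeries, sub_neg_eq_add]
    rcases lt_or_ge (p + k) 0 with h | h
    · rw [zcoeff_of_neg _ h, mul_zero, hlow y p (by omega)]
    · obtain ⟨n, hn⟩ : ∃ n : ℕ, p + k = n := ⟨(p + k).toNat, by omega⟩
      rw [hn, zcoeff_natCast, PowerSeries.coeff_mk, mul_inv_cancel_left₀ hy,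
        show (n : ℤ) - k = p by omega]
  refine ⟨k, -b, fun t => ⟨fun p hp => ?_, fun j => ?_⟩⟩
  · rw [wave_shift]
    exact coeff_mul_ofPowerSeries_eq_zero (hlow' _) _ hp
  · have h := hτ.residue_wave_mul_even (t + -b) y j
    rw [hF, ← hb, mul_left_comm, mul_assoc, mul_comm (HahnSeries.single (-k : ℤ) a),
      mul_assoc, HahnSeries.single_mul_single, mul_comm, HahnSeries.coeff_single_mul] at h
    rw [wave_shift, neg_neg, ← (mul_eq_zero.1 h).resolve_left (by simpa using hy)]
    congr 1
    ring

theorem shift_smul (c : ℕ+ → ℂ) (a : ℂ) (τ : TimePoly) : shift c (a • τ) = a • shift c τ := by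
  rw [shift_eq_bind₁, shift_eq_bind₁, MvPolynomial.smul_eq_C_mul, MvPolynomial.smul_eq_C_mul,
    map_mul, MvPolynomial.bind₁_C_right]

theorem isKdVTau_iff (τ : TimePoly) : IsKdVTau τ ↔
    ∃ (k : ℕ) (c : ℕ+ → ℂ) (a : ℂ), a ≠ 0 ∧ τ = a • shift c (kdvTau k) := by
  constructor
  · intro hτ
    obtain ⟨k, c, hc⟩ := hτ.exists_shift_inStairSpace
    obtain ⟨a, ha, h⟩ := exists_eq_smul_of_residue (shift_ne_zero hτ.1.1 c) (kdvTau_ne_zero k)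
      fun t y => by
        rw [(indepOfEven_kdvTau k).dualWave_eq]
        exact (hc t).residue_mul (inStairSpace_wave_kdvTau k _).negZ
    refine ⟨k, -c, a, ha, ?_⟩
    have h2 := congrArg (shift (-c)) h
    rw [shift_shift, neg_add_cancel, shift_zero] at h2
    rw [h2, shift_smul]
  · rintro ⟨k, c, a, ha, rfl⟩
    exact ((isKdVTau_kdvTau k).shift c).smul ha

/-! ### Squares of series with `E(z) E(-z) = 1` -/

section Square

open PowerSeries

variable {R : Type*} [CommRing R]

theorem zcoeff_rescale_neg (F : PowerSeries R) (b M : ℕ) :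
    zcoeff (rescale (-1) F) ((b : ℤ) - M) = (-1) ^ (b + M) * zcoeff F ((b : ℤ) - M) := by
  rcases lt_or_ge b M with h | h
  · rw [zcoeff_of_neg _ (by omega), zcoeff_of_neg _ (by omega), mul_zero]
  · obtain ⟨a, rfl⟩ := Nat.exists_eq_add_of_le h
    have : ((M + a : ℕ) : ℤ) - M = a := by push_cast; ring
    rw [this, zcoeff_natCast, zcoeff_natCast, coeff_rescale, show M + a + M = a + 2 * M by ring,
      pow_add, pow_mul]
    simp

theorem zcoeff_mul_shifted (F G : PowerSeries R) {n : ℤ} {M N : ℕ} (hN : n < N) :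
    zcoeff (F * G) n = ∑ b ∈ Finset.range (M + N),
      zcoeff G ((b : ℤ) - M) * zcoeff F (n - ((b : ℤ) - M)) := by
  rw [Finset.sum_range_add, Finset.sum_eq_zero (s := Finset.range M), zero_add,
    zcoeff_mul F G hN]
  · refine Finset.sum_congr rfl fun a _ => ?_
    have : ((M + a : ℕ) : ℤ) - M = a := by push_cast; ring
    rw [this, zcoeff_natCast]
  · intro b hb
    rw [Finset.mem_range] at hb
    rw [zcoeff_of_neg _ (by omega), zero_mul]

/-- The rows of the Hankel matrix of `E²` are combinations of rows of the matrix defining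
`stairDet E k`. -/
theorem zcoeff_sq {E : PowerSeries R} (hE : E * rescale (-1) E = 1) {k q j : ℕ} (hq : q ≤ k)
    (hj : j ≤ k) : zcoeff (E * E) ((q : ℤ) + j) = (-1) ^ (k - q) * zcoeff 1 ((q : ℤ) + j) +
      ∑ i : Fin k, 2 * zcoeff E (2 * (i : ℕ) + 1 - ((k : ℤ) - q)) *
        zcoeff E ((k : ℤ) - 1 - 2 * (i : ℕ) + j) := by
  obtain ⟨M, rfl⟩ := Nat.exists_eq_add_of_le hq
  have hN : (q : ℤ) + j < (2 * q + M + 1 : ℕ) := by push_cast at *; omega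
  have h1 := zcoeff_mul_shifted E E (M := M) hN
  have h2 := zcoeff_mul_shifted E (rescale (-1) E) (M := M) hN
  rw [hE] at h2
  -- With M = k - q, the exponent is b - M, so subtracting (-1)^M E(z)E(-z) from E(z)² cancels the
  -- terms with b even and doubles those with b odd.
  have h3 : zcoeff (E * E) ((q : ℤ) + j) - (-1) ^ M * zcoeff 1 ((q : ℤ) + j) =
      ∑ b ∈ Finset.range (2 * (q + M) + 1), (1 - (-1) ^ b) *
        (zcoeff E ((b : ℤ) - M) * zcoeff E (q + j - ((b : ℤ) - M))) := by
    rw [h1, h2, Finset.mul_sum, ← Finset.sum_sub_distrib,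
      show M + (2 * q + M + 1) = 2 * (q + M) + 1 by ring]
    refine Finset.sum_congr rfl fun b _ => ?_
    rw [zcoeff_rescale_neg, pow_add]
    have : ((-1 : R) ^ M) * (-1) ^ M = 1 := by rw [← mul_pow]; simp
    linear_combination
      (-(-1) ^ b * zcoeff E ((b : ℤ) - M) * zcoeff E (q + j - ((b : ℤ) - M))) * this
  -- The top index b = 2(q + M) is even and drops out; the surviving b = 2i + 1 give i < k.
  rw [Finset.sum_range_succ, sum_range_two_mul, pow_mul (-1 : R)] at h3
  simp only [pow_add, pow_mul, neg_one_sq, one_pow, sub_self, zero_mul, zero_add, add_zero,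
    pow_one, one_mul, sub_neg_eq_add, one_add_one_eq_two] at h3
  rw [Nat.add_sub_cancel_left, ← sub_eq_iff_eq_add', h3, ← Fin.sum_univ_eq_sum_range
    (fun l => 2 * (zcoeff E (((2 * l + 1 : ℕ) : ℤ) - M) *
      zcoeff E (q + j - (((2 * l + 1 : ℕ) : ℤ) - M))))]
  refine Finset.sum_congr rfl fun i _ => ?_
  rw [mul_assoc]
  congr 3 <;> push_cast <;> ring

theorem zcoeff_one_of_pos {n : ℤ} (hn : 0 < n) : zcoeff (1 : PowerSeries R) n = 0 := by
  lift n to ℕ using hn.le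
  rw [zcoeff_natCast, coeff_one, if_neg (by omega)]

/-- The cofactors annihilate every row in `zcoeff_sq`; what remains is the coefficient of E(z)E(-z)
= 1, present only for q = j = 0. -/
theorem sum_zcoeff_sq_mul_borderCofactor {E : PowerSeries R} (hE : E * rescale (-1) E = 1)
    {k q : ℕ} (hq : q ≤ k) :
    ∑ j : Fin (k + 1), zcoeff (E * E) ((q : ℤ) + (j : ℕ)) * borderCofactor E k j =
      if q = 0 then (-1) ^ k * stairDet E k else 0 := by
  have h : ∀ j : Fin (k + 1), zcoeff (E * E) ((q : ℤ) + (j : ℕ)) * borderCofactor E k j =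
      (-1) ^ (k - q) * zcoeff 1 ((q : ℤ) + (j : ℕ)) * borderCofactor E k j +
      ∑ i : Fin k, 2 * zcoeff E (2 * (i : ℕ) + 1 - ((k : ℤ) - q)) *
        (zcoeff E ((k : ℤ) - 1 - 2 * (i : ℕ) + (j : ℕ)) * borderCofactor E k j) := fun j => by
    rw [zcoeff_sq hE hq (by omega), add_mul, Finset.sum_mul]
    simp only [mul_assoc]
  simp only [h]
  rw [Finset.sum_add_distrib, Finset.sum_comm]
  simp only [← Finset.mul_sum, sum_row_mul_borderCofactor, mul_zero, Finset.sum_const_zero,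
    add_zero]
  split_ifs with h0
  · subst h0
    rw [Fin.sum_univ_succ, Finset.sum_eq_zero, borderCofactor_zero]
    · simp [zcoeff]
    · intro j _
      rw [zcoeff_one_of_pos (by simp)]
      ring
  · refine Finset.sum_eq_zero fun j _ => ?_
    rw [zcoeff_one_of_pos (by omega)]
    ring

/-- The constant in `det_hankel_sq`. -/
def hankelConst (k : ℕ) : ℤ := (-1) ^ k * 2 ^ k * Equiv.Perm.sign (Fin.revPerm : Equiv.Perm (Fin k))

theorem hankelConst_ne_zero (k : ℕ) : hankelConst k ≠ 0 := by
  simp [hankelConst]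

/-- The Hankel determinant of `E²` is a multiple of the square of the staircase determinant. -/
theorem det_hankel_sq {E : PowerSeries R} (hE : E * rescale (-1) E = 1) (k : ℕ) :
    Matrix.det (Matrix.of fun q j : Fin (k + 1) => coeff ((q : ℕ) + (j : ℕ)) (E * E)) =
      hankelConst k * stairDet E k ^ 2 := by
  -- T collects the coefficients of `zcoeff_sq`. Its first column is a multiple of a unit vector,
  -- and the complementary minor is twice a transposed staircase matrix with rows reversed, so the
  -- staircase determinant enters both factors.
  let T : Matrix (Fin (k + 1)) (Fin (k + 1)) R := Matrix.of fun q => Fin.cons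
    (if q = 0 then (-1) ^ k else 0) fun i : Fin k =>
      2 * zcoeff E (2 * (i : ℕ) + 1 - ((k : ℤ) - (q : ℕ)))
  have hprod : (Matrix.of fun q j : Fin (k + 1) => coeff ((q : ℕ) + (j : ℕ)) (E * E)) =
      T * borderMatrix E k (Fin.cons 1 0) := by
    ext q j
    rw [Matrix.mul_apply, Matrix.of_apply, ← zcoeff_natCast, Nat.cast_add,
      zcoeff_sq hE (by omega : (q : ℕ) ≤ k) (by omega : (j : ℕ) ≤ k), Fin.sum_univ_succ]
    congr 1
    · refine Fin.cases ?_ (fun j => ?_) j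
      · refine Fin.cases ?_ (fun q => ?_) q
        · simp [T, zcoeff]
        · rw [zcoeff_one_of_pos (by simp)]
          simp [T, Fin.succ_ne_zero]
      · rw [zcoeff_one_of_pos (by rw [Fin.val_succ]; omega)]
        simp
  have hT : T.det = hankelConst k * stairDet E k := by
    rw [Matrix.det_succ_column_zero, Fin.sum_univ_succ, Finset.sum_eq_zero, add_zero]
    · have h1 : T.submatrix (Fin.succAbove 0) Fin.succ = (2 : R) •
          (Matrix.submatrix (Matrix.of fun i j : Fin k =>
            zcoeff E ((k : ℤ) - 2 * (i : ℕ) + (j : ℕ))) Fin.revPerm id).transpose := by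
        ext q i
        have hi := i.2
        simp only [T, Matrix.submatrix_apply, Matrix.of_apply, Fin.cons_succ, Matrix.smul_apply,
          Matrix.transpose_apply, smul_eq_mul, Fin.revPerm_apply, Fin.val_rev, id,
          Fin.zero_succAbove, Fin.val_succ]
        congr 2
        omega
      rw [h1, Matrix.det_smul, Matrix.det_transpose, Matrix.det_permute, Fintype.card_fin]
      simp only [T, Matrix.of_apply, Fin.cons_zero, if_true, Fin.val_zero, pow_zero, one_mul,
        hankelConst, stairDet]
      push_cast
      ring
    · intro q _
      simp [T, Fin.succ_ne_zero]
  rw [hprod, Matrix.det_mul, hT, det_borderMatrix, Fin.sum_univ_succ]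
  simp only [Fin.cons_zero, Fin.cons_succ, Pi.zero_apply, zero_mul, Finset.sum_const_zero,
    borderCofactor_zero]
  ring

end Square

/-! ### BKP tau-functions -/

/-- A positive exponent in one factor must exceed k, and then its partner lies below -k. -/
theorem coeff_mul_zero_of_gap {k : ℕ} {f g : LaurentSeries ℂ}
    (hf : ∀ p : ℤ, p < -k → f.coeff p = 0) (hf' : ∀ p : ℤ, 0 < p → p ≤ k → f.coeff p = 0)
    (hg : ∀ p : ℤ, p < -k → g.coeff p = 0) (hg' : ∀ p : ℤ, 0 < p → p ≤ k → g.coeff p = 0) :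
    (f * g).coeff 0 = f.coeff 0 * g.coeff 0 := by
  rw [HahnSeries.coeff_mul, Finset.sum_eq_single (0, 0)]
  · rintro ⟨p, q⟩ hpq hne
    rw [Finset.mem_antidiagonal] at hpq
    have hs : p + q = 0 := hpq.2.2
    have hp : p ≠ 0 := fun h => hne (by rw [h, show q = 0 by omega])
    rcases lt_or_gt_of_ne hp with h | h
    · by_cases h2 : p < -k
      · simp [hf p h2]
      · simp [hg' q (by omega) (by omega)]
    · by_cases h2 : p ≤ k
      · simp [hf' p h h2]
      · simp [hg q (by omega)]
  · intro h
    rw [Finset.mem_antidiagonal] at h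
    simp only [HahnSeries.mem_support, add_zero, and_true] at h
    by_contra hne
    exact h ⟨left_ne_zero_of_mul hne, right_ne_zero_of_mul hne⟩

theorem halfShift_eq_bind₁ (c : ℕ+ → ℂ) (τ : TimePoly) : halfShift c τ =
    MvPolynomial.bind₁ (fun i => MvPolynomial.C (1 / 2 : ℂ) *
      ((MvPolynomial.X i : TimePoly) + MvPolynomial.C (c i))) τ := rfl

theorem eval_halfShift (t c : ℕ+ → ℂ) (τ : TimePoly) :
    MvPolynomial.eval t (halfShift c τ) = MvPolynomial.eval ((1 / 2 : ℂ) • (t + c)) τ := by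
  rw [halfShift_eq_bind₁, MvPolynomial.eval, MvPolynomial.eval₂Hom_bind₁]
  congr 2
  funext i
  simp

theorem evalShift_halfShift (τ : TimePoly) (c t : ℕ+ → ℂ) (a : ℂ) (u : ℕ+ → LaurentSeries ℂ) :
    evalShift (halfShift c τ) t (2 * a) u = evalShift τ ((1 / 2 : ℂ) • (t + c)) a u := by
  rw [halfShift_eq_bind₁, evalShift_bind₁, evalShift_eq]
  congr 2
  funext i
  simp only [evalShift_eq, map_mul, map_add, MvPolynomial.eval₂Hom_X', MvPolynomial.eval₂Hom_C,
    Pi.smul_apply, Pi.add_apply, smul_eq_mul]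
  have h : (HahnSeries.C (1 / 2 : ℂ) : LaurentSeries ℂ) * HahnSeries.C 2 = 1 := by
    rw [← map_mul]
    norm_num
  linear_combination (HahnSeries.C a * u i) * h

theorem IndepOfEven.evalShift_oddOnly {τ : TimePoly} (hτ : IndepOfEven τ) (t : ℕ+ → ℂ) (a : ℂ) :
    evalShift τ t a (oddOnly zInv) = evalShift τ (oddOnly t) a zInv :=
  hτ.eval₂Hom_congr _ fun i hi => by simp [oddOnly, hi]

theorem halfShift_kdvTau_ne_zero (k : ℕ) (c : ℕ+ → ℂ) : halfShift c (kdvTau k) ≠ 0 := by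
  intro h
  refine kdvTau_ne_zero k (MvPolynomial.funext fun t => ?_)
  have h1 := eval_halfShift ((2 : ℂ) • t - c) c (kdvTau k)
  rw [h, sub_add_cancel, smul_smul] at h1
  norm_num at h1
  rw [← h1, map_zero]

theorem indepOfEven_halfShift {τ : TimePoly} (hτ : IndepOfEven τ) (c : ℕ+ → ℂ) :
    IndepOfEven (halfShift c τ) := by
  rw [halfShift_eq_bind₁]
  exact hτ.bind₁ fun i hi => (indepOfEven_C _).mul ((indepOfEven_X hi).add (indepOfEven_C _))

theorem eval_kdvTau (k : ℕ) (t : ℕ+ → ℂ) :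
    MvPolynomial.eval t (kdvTau k) = stairDet (expTimes (oddOnly t)) k := by
  rw [stairDet_expTimes_oddOnly, map_kdvTau]
  simp only [MvPolynomial.eval_X]

theorem isBKPTau_halfShift_kdvTau (k : ℕ) (c : ℕ+ → ℂ) : IsBKPTau (halfShift c (kdvTau k)) := by
  have hτ := indepOfEven_kdvTau k
  refine ⟨halfShift_kdvTau_ne_zero k c, indepOfEven_halfShift hτ c, fun t y => ?_⟩
  let half : (ℕ+ → ℂ) → ℕ+ → ℂ := fun t => oddOnly ((1 / 2 : ℂ) • (t + c))
  -- The half times enter the exponential squared, so the product of A(t)(z) and A(y)(-z) carries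
  -- the full exponential of t - y, the shifts c cancelling.
  let A : (ℕ+ → ℂ) → LaurentSeries ℂ := fun t => evalShift (kdvTau k) (half t) (-1) zInv *
    ((expTimes (half t) * expTimes (half t) : PowerSeries ℂ) : LaurentSeries ℂ)
  have hlow : ∀ t (p : ℤ), p < -k → (A t).coeff p = 0 := fun t p hp => by
    rw [coeff_evalShift_kdvTau_mul]
    refine Finset.sum_eq_zero fun j _ => ?_
    rw [zcoeff_of_neg _ (by omega), zero_mul]
  have hgap : ∀ t (p : ℤ), 0 < p → p ≤ k → (A t).coeff p = 0 := fun t p hp hpk => by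
    lift p to ℕ using hp.le
    rw [coeff_evalShift_kdvTau_mul, sum_zcoeff_sq_mul_borderCofactor
      (expTimes_oddOnly_mul_rescale _) (by omega), if_neg (by omega)]
  have hzero : ∀ t, (A t).coeff 0 = (-1) ^ k * MvPolynomial.eval t (halfShift c (kdvTau k)) :=
    fun t => by
      have h := sum_zcoeff_sq_mul_borderCofactor
        (expTimes_oddOnly_mul_rescale ((1 / 2 : ℂ) • (t + c))) (Nat.zero_le k)
      rw [if_pos rfl, ← eval_kdvTau, ← eval_halfShift, Nat.cast_zero] at h
      rw [coeff_evalShift_kdvTau_mul, h]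
  have hexp : expTimes (oddOnly (t - y)) = expTimes (half t) * expTimes (half t) *
      PowerSeries.rescale (-1) (expTimes (half y) * expTimes (half y)) := by
    rw [map_mul, rescale_expTimes, ← expTimes_add, ← expTimes_add, ← expTimes_add]
    congr 1
    funext i
    by_cases hi : Odd (i : ℕ)
    · simp [half, oddOnly, hi, hi.neg_one_pow]
      ring
    · simp [half, oddOnly, hi]
  have h1 : evalShift (halfShift c (kdvTau k)) t (-2) (oddOnly zInv) =
      evalShift (kdvTau k) (half t) (-1) zInv := by
    rw [show (-2 : ℂ) = 2 * -1 by norm_num, evalShift_halfShift, hτ.evalShift_oddOnly]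
  have h2 : evalShift (halfShift c (kdvTau k)) y 2 (oddOnly zInv) =
      negZ (evalShift (kdvTau k) (half y) (-1) zInv) := by
    conv_lhs => rw [show (2 : ℂ) = 2 * 1 by norm_num]
    rw [evalShift_halfShift, hτ.evalShift_oddOnly, hτ.evalShift_one]
  have h3 : evalShift (halfShift c (kdvTau k)) t (-2) (oddOnly zInv) *
      evalShift (halfShift c (kdvTau k)) y 2 (oddOnly zInv) *
        ((expTimes (oddOnly (t - y)) : PowerSeries ℂ) : LaurentSeries ℂ) = A t * negZ (A y) := by
    have hA : negZ (A y) = negZ (evalShift (kdvTau k) (half y) (-1) zInv) *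
        (PowerSeries.rescale (-1) (expTimes (half y) * expTimes (half y)) : PowerSeries ℂ) := by
      rw [← negZ_ofPowerSeries, ← map_mul]
    rw [h1, h2, hexp, PowerSeries.coe_mul, hA]
    ring
  rw [h3, coeff_mul_zero_of_gap (hlow t) (hgap t)
    (fun p hp => by rw [coeff_negZ, hlow y p hp, mul_zero])
    (fun p hp hpk => by rw [coeff_negZ, hgap y p hp hpk, mul_zero]), coeff_negZ, hzero, hzero,
    zpow_zero, one_mul, mul_mul_mul_comm, ← mul_pow]
  simp

/-! ### Pfaffians -/

section Pfaffian

variable {R S : Type*} [CommRing R] [CommRing S] {m : ℕ}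

/-- The sum over permutations in the definition of the Pfaffian, with rows and columns indexed by
`Fin 2 × Fin m`. -/
def pfSum (A : Matrix (Fin 2 × Fin m) (Fin 2 × Fin m) R) : R :=
  ∑ σ : Equiv.Perm (Fin 2 × Fin m), ((Equiv.Perm.sign σ : ℤ) : R) *
    ∏ i : Fin m, A (σ (0, i)) (σ (1, i))

theorem map_pfSum (f : R →+* S) (A : Matrix (Fin 2 × Fin m) (Fin 2 × Fin m) R) :
    f (pfSum A) = pfSum (A.map f) := by
  simp [pfSum]

/-- The equivalence `(a, i) ↦ 2 i + a`. -/
def pairEquiv (m : ℕ) : Fin 2 × Fin m ≃ Fin (2 * m) :=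
  (Equiv.prodComm _ _).trans (finProdFinEquiv.trans (finCongr (mul_comm m 2)))

theorem pairEquiv_zero (i : Fin m) : pairEquiv m (0, i) = ⟨2 * (i : ℕ), by omega⟩ := by
  ext
  simp [pairEquiv]

theorem pairEquiv_one (i : Fin m) : pairEquiv m (1, i) = ⟨2 * (i : ℕ) + 1, by omega⟩ := by
  ext
  simp [pairEquiv, add_comm]

theorem pfaffian_eq [Algebra ℚ R] (A : Matrix (Fin (2 * m)) (Fin (2 * m)) R) :
    pfaffian A = algebraMap ℚ R (1 / (2 ^ m * (Nat.factorial m : ℚ))) *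
      pfSum (A.submatrix (pairEquiv m) (pairEquiv m)) := by
  rw [pfaffian, pfSum, ← (pairEquiv m).permCongr.sum_comp]
  congr 1
  refine Finset.sum_congr rfl fun σ _ => ?_
  rw [Equiv.Perm.sign_permCongr]
  congr 1
  refine Finset.prod_congr rfl fun i _ => ?_
  rw [← pairEquiv_zero, ← pairEquiv_one]
  simp

/-- Multilinear expansion gives a sum over all maps h, weighted by the determinant of B with columns
chosen by h. It vanishes for h not injective and is a sign times det B for a permutation. -/
theorem pfSum_mul_mul_transpose (A B : Matrix (Fin 2 × Fin m) (Fin 2 × Fin m) R) :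
    pfSum (B * A * B.transpose) = B.det * pfSum A := by
  have hentry : ∀ x y, (B * A * B.transpose) x y =
      ∑ g : Fin 2 → Fin 2 × Fin m, A (g 0) (g 1) * (B x (g 0) * B y (g 1)) := by
    intro x y
    rw [← (finTwoArrowEquiv (Fin 2 × Fin m)).symm.sum_comp, Fintype.sum_prod_type_right]
    simp only [Matrix.mul_apply, Matrix.transpose_apply, Finset.sum_mul]
    refine Finset.sum_congr rfl fun b _ => Finset.sum_congr rfl fun a _ => ?_
    simp [finTwoArrowEquiv]
    ring
  have hprod : ∀ σ : Equiv.Perm (Fin 2 × Fin m),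
      ∏ i, (B * A * B.transpose) (σ (0, i)) (σ (1, i)) =
      ∑ h : Fin 2 × Fin m → Fin 2 × Fin m,
        (∏ i, A (h (0, i)) (h (1, i))) * ∏ x, B (σ x) (h x) := by
    intro σ
    simp only [hentry]
    rw [Finset.prod_univ_sum, Fintype.piFinset_univ]
    refine Fintype.sum_equiv ((Equiv.curry (Fin m) (Fin 2) (Fin 2 × Fin m)).symm.trans
      (Equiv.arrowCongr (Equiv.prodComm _ _) (Equiv.refl _))) _ _ fun f => ?_
    rw [Fintype.prod_prod_type, Fin.prod_univ_two, Finset.prod_mul_distrib,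
      Finset.prod_mul_distrib]
    rfl
  have hdet : ∀ h : Fin 2 × Fin m → Fin 2 × Fin m,
      ∑ σ : Equiv.Perm (Fin 2 × Fin m), ((Equiv.Perm.sign σ : ℤ) : R) * ∏ x, B (σ x) (h x) =
        (B.submatrix id h).det := fun h => by
    rw [Matrix.det_apply']
    rfl
  have hsum : pfSum (B * A * B.transpose) = ∑ h : Fin 2 × Fin m → Fin 2 × Fin m,
      (∏ i, A (h (0, i)) (h (1, i))) * (B.submatrix id h).det := by
    simp only [pfSum, hprod, Finset.mul_sum, ← hdet]
    rw [Finset.sum_comm]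
    refine Finset.sum_congr rfl fun h _ => Finset.sum_congr rfl fun σ _ => ?_
    ring
  rw [hsum, pfSum, Finset.mul_sum]
  refine (Finset.sum_of_injOn (fun σ : Equiv.Perm (Fin 2 × Fin m) => (σ : _ → _))
    (fun σ _ τ _ h => Equiv.coe_fn_injective h) (fun _ _ => Finset.mem_coe.2 (Finset.mem_univ _))
    (fun h _ hh => ?_) (fun σ _ => ?_)).symm
  · have hinj : ¬ Function.Injective h := fun hinj =>
      hh ⟨Equiv.ofBijective h (Finite.injective_iff_bijective.1 hinj), by simp, rfl⟩
    rw [Function.Injective] at hinj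
    push Not at hinj
    obtain ⟨x, y, hxy, hne⟩ := hinj
    rw [Matrix.det_zero_of_column_eq hne (fun i => by simp [hxy]), mul_zero]
  · rw [Matrix.det_permute']
    ring

/-- The standard symplectic matrix. -/
def symplecticMatrix (m : ℕ) : Matrix (Fin 2 × Fin m) (Fin 2 × Fin m) ℤ :=
  Matrix.blockDiagonal fun _ => !![0, 1; -1, 0]

theorem det_symplecticMatrix (m : ℕ) : (symplecticMatrix m).det = 1 := by
  simp [symplecticMatrix, Matrix.det_blockDiagonal]

/-- A permutation contributes only if it maps pairs to pairs. Permuting whole pairs is even, and the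
flips inside pairs contribute their sign twice, so no term is negative; the identity gives 1. Only
the nonvanishing is needed later. -/
theorem pfSum_symplecticMatrix_pos (m : ℕ) : 0 < pfSum (symplecticMatrix m) := by
  have hJ : ∀ x y : Fin 2 × Fin m, symplecticMatrix m x y =
      if x.2 = y.2 then (!![0, 1; -1, 0] : Matrix (Fin 2) (Fin 2) ℤ) x.1 y.1 else 0 :=
    fun x y => Matrix.blockDiagonal_apply _ _ _
  have key : ∀ σ : Equiv.Perm (Fin 2 × Fin m), 0 ≤ (Equiv.Perm.sign σ : ℤ) *
      ∏ i : Fin m, symplecticMatrix m (σ (0, i)) (σ (1, i)) := by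
    intro σ
    by_cases h0 : ∀ i, (σ (0, i)).2 = (σ (1, i)).2
    · have hsnd : ∀ a i, (σ (a, i)).2 = (σ (0, i)).2 := fun a i => by
        fin_cases a
        · rfl
        · exact (h0 i).symm
      have hsurj : Function.Surjective fun i => (σ (0, i)).2 := fun p =>
        ⟨(σ.symm (0, p)).2, by
          have h1 := hsnd (σ.symm (0, p)).1 (σ.symm (0, p)).2
          simpa using h1.symm⟩
      let π : Equiv.Perm (Fin m) := Equiv.ofBijective _ (Finite.surjective_iff_bijective.1 hsurj)
      have hinj : ∀ i, Function.Injective fun a => (σ (a, i)).1 := fun i a b hab => by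
        have h1 : σ (a, i) = σ (b, i) := Prod.ext hab ((hsnd a i).trans (hsnd b i).symm)
        exact congrArg Prod.fst (σ.injective h1)
      let ρ : Fin m → Equiv.Perm (Fin 2) := fun i =>
        Equiv.ofBijective _ (Finite.injective_iff_bijective.1 (hinj i))
      have hσ : σ = Equiv.prodCongrRight (fun _ : Fin 2 => π) * Equiv.prodCongrLeft ρ := by
        refine Equiv.ext fun x => ?_
        obtain ⟨a, i⟩ := x
        exact Prod.ext rfl (hsnd a i)
      have hsign : ∀ ρ : Equiv.Perm (Fin 2),
          (!![0, 1; -1, 0] : Matrix (Fin 2) (Fin 2) ℤ) (ρ 0) (ρ 1) = Equiv.Perm.sign ρ := by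
        decide
      have hprod : ∏ i : Fin m, symplecticMatrix m (σ (0, i)) (σ (1, i)) =
          ∏ i : Fin m, (Equiv.Perm.sign (ρ i) : ℤ) :=
        Finset.prod_congr rfl fun i _ => by
          rw [hJ, if_pos (h0 i), ← hsign]
          rfl
      rw [hprod, hσ, map_mul, Equiv.Perm.sign_prodCongrRight, Equiv.Perm.sign_prodCongrLeft,
        Fin.prod_univ_two, Int.units_mul_self, one_mul, Units.coe_prod]
      exact mul_self_nonneg _
    · push Not at h0
      obtain ⟨i, hi⟩ := h0
      rw [Finset.prod_eq_zero (Finset.mem_univ i) (by rw [hJ, if_neg hi]), mul_zero]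
  have hone : (1 : ℤ) ≤ pfSum (symplecticMatrix m) := by
    refine le_trans ?_ (Finset.single_le_sum (fun σ _ => key σ)
      (Finset.mem_univ (1 : Equiv.Perm (Fin 2 × Fin m))))
    simp [hJ]
  omega

end Pfaffian

/-! ### Symplectic bases and the square of the Pfaffian -/

section Symplectic

variable {K V : Type*} [Field K] [AddCommGroup V] [Module K V]

/-- A symplectic family in a space with a nondegenerate alternating form can be extended as long
as it does not span. -/
theorem exists_symplectic_extension {β : LinearMap.BilinForm K V} (hβ : β.IsAlt)
    (hnd : ∀ v, (∀ w, β v w = 0) → v = 0) {m : ℕ} (hm : 2 * m < Module.finrank K V)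
    {a b : Fin m → V} (haa : ∀ i j, β (a i) (a j) = 0) (hbb : ∀ i j, β (b i) (b j) = 0)
    (hab : ∀ i j, β (a i) (b j) = if i = j then 1 else 0) :
    ∃ a' b' : Fin (m + 1) → V, (∀ i j, β (a' i) (a' j) = 0) ∧ (∀ i j, β (b' i) (b' j) = 0) ∧
      ∀ i j, β (a' i) (b' j) = if i = j then 1 else 0 := by
  have hba : ∀ i j, β (b i) (a j) = if i = j then -1 else 0 := fun i j => by
    rw [← hβ.neg_eq, hab]
    simp only [eq_comm (a := j)]
    split_ifs <;> simp
  -- P projects onto the orthogonal complement of the given symplectic family.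
  let P : V → V := fun v => v - ∑ i, (β v (b i) • a i - β v (a i) • b i)
  have hPa : ∀ v j, β (P v) (a j) = 0 := fun v j => by
    simp [P, haa, hba]
  have hPb : ∀ v j, β (P v) (b j) = 0 := fun v j => by
    simp [P, hbb, hab]
  have haP : ∀ v j, β (a j) (P v) = 0 := fun v j => by rw [← hβ.neg_eq, hPa, neg_zero]
  have hbP : ∀ v j, β (b j) (P v) = 0 := fun v j => by rw [← hβ.neg_eq, hPb, neg_zero]
  obtain ⟨v, hv⟩ : ∃ v, P v ≠ 0 := by
    by_contra! h
    have hspan : Submodule.span K (Set.range (Sum.elim a b)) = ⊤ := by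
      rw [eq_top_iff]
      intro v _
      have h1 : v = ∑ i, (β v (b i) • a i - β v (a i) • b i) := sub_eq_zero.1 (h v)
      rw [h1]
      refine Submodule.sum_mem _ fun i _ => Submodule.sub_mem _ (Submodule.smul_mem _ _ ?_)
        (Submodule.smul_mem _ _ ?_)
      · exact Submodule.subset_span ⟨Sum.inl i, rfl⟩
      · exact Submodule.subset_span ⟨Sum.inr i, rfl⟩
    have h2 := finrank_range_le_card (R := K) (Sum.elim a b)
    rw [Set.finrank, hspan, finrank_top, Fintype.card_sum, Fintype.card_fin] at h2
    omega
  obtain ⟨w, hw⟩ : ∃ w, β (P v) w ≠ 0 := by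
    by_contra! h
    exact hv (hnd _ h)
  have hPP : β (P v) (P ((β (P v) w)⁻¹ • w)) = 1 := by
    have h1 : ∀ u, β (P v) (P u) = β (P v) u := fun u => by
      conv_lhs => rw [show P u = u - ∑ i, (β u (b i) • a i - β u (a i) • b i) from rfl]
      simp [LinearMap.BilinForm.sub_right, hPa, hPb]
    rw [h1, map_smul, smul_eq_mul, inv_mul_cancel₀ hw]
  refine ⟨Fin.cons (P v) a, Fin.cons (P ((β (P v) w)⁻¹ • w)) b, ?_, ?_, ?_⟩
  · intro i j
    refine Fin.cases ?_ (fun i => ?_) i <;> refine Fin.cases ?_ (fun j => ?_) j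
    · exact hβ.self_eq_zero _
    · exact hPa _ _
    · exact haP _ _
    · exact haa _ _
  · intro i j
    refine Fin.cases ?_ (fun i => ?_) i <;> refine Fin.cases ?_ (fun j => ?_) j
    · exact hβ.self_eq_zero _
    · exact hPb _ _
    · exact hbP _ _
    · exact hbb _ _
  · intro i j
    refine Fin.cases ?_ (fun i => ?_) i <;> refine Fin.cases ?_ (fun j => ?_) j
    · simpa using hPP
    · simpa [(Fin.succ_ne_zero j).symm] using hPb _ _
    · simpa [Fin.succ_ne_zero i] using haP _ _
    · simpa [Fin.succ_inj] using hab i j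

theorem exists_symplectic_family {β : LinearMap.BilinForm K V} (hβ : β.IsAlt)
    (hnd : ∀ v, (∀ w, β v w = 0) → v = 0) {m : ℕ} (hm : 2 * m ≤ Module.finrank K V) :
    ∃ a b : Fin m → V, (∀ i j, β (a i) (a j) = 0) ∧ (∀ i j, β (b i) (b j) = 0) ∧
      ∀ i j, β (a i) (b j) = if i = j then 1 else 0 := by
  induction m with
  | zero => exact ⟨Fin.elim0, Fin.elim0, fun i => i.elim0, fun i => i.elim0, fun i => i.elim0⟩
  | succ m ih =>
    obtain ⟨a, b, haa, hbb, hab⟩ := ih (by omega)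
    exact exists_symplectic_extension hβ hnd (by omega) haa hbb hab

/-- The rows of B are a symplectic basis for the form with matrix A. -/
theorem exists_mul_mul_transpose_eq [CharZero K] {m : ℕ}
    {A : Matrix (Fin 2 × Fin m) (Fin 2 × Fin m) K} (hA : A.transpose = -A) (hdet : A.det ≠ 0) :
    ∃ B : Matrix (Fin 2 × Fin m) (Fin 2 × Fin m) K,
      B * A * B.transpose = (symplecticMatrix m).map (Int.castRingHom K) := by
  have happ : ∀ x y, Matrix.toBilin' A x y = x ⬝ᵥ A.mulVec y := fun x y =>
    Matrix.toBilin'_apply' A x y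
  have halt : (Matrix.toBilin' A).IsAlt := fun x => by
    have h : x ⬝ᵥ A.mulVec x = -(x ⬝ᵥ A.mulVec x) := by
      conv_lhs => rw [Matrix.dotProduct_mulVec, ← Matrix.mulVec_transpose, hA, Matrix.neg_mulVec,
        neg_dotProduct, dotProduct_comm]
    rw [happ]
    exact self_eq_neg.1 h
  have hnd : ∀ v, (∀ w, Matrix.toBilin' A v w = 0) → v = 0 := fun v hv => by
    refine Matrix.eq_zero_of_vecMul_eq_zero hdet (dotProduct_eq_zero _ fun w => ?_)
    rw [← Matrix.dotProduct_mulVec, ← happ, hv]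
  obtain ⟨a, b, haa, hbb, hab⟩ := exists_symplectic_family halt hnd (m := m) (by simp)
  have hba : ∀ i j, Matrix.toBilin' A (b i) (a j) = if i = j then -1 else 0 := fun i j => by
    rw [← halt.neg_eq, hab]
    simp only [eq_comm (a := j)]
    split_ifs <;> simp
  refine ⟨Matrix.of fun x => if x.1 = 0 then a x.2 else b x.2, ?_⟩
  ext ⟨p, i⟩ ⟨q, j⟩
  rw [Matrix.mul_mul_apply, Matrix.transpose_transpose, ← happ, Matrix.map_apply, symplecticMatrix,
    Matrix.blockDiagonal_apply]
  fin_cases p <;> fin_cases q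
  · exact (haa i j).trans (by simp)
  · exact (hab i j).trans (by simp)
  · exact (hba i j).trans (by simp)
  · exact (hbb i j).trans (by simp)

/-- The square of the Pfaffian is a nonzero multiple of the determinant. -/
theorem exists_pfaffian_sq_eq (m : ℕ) : ∃ κ : ℚ, κ ≠ 0 ∧
    ∀ {R : Type*} [CommRing R] [IsDomain R] [Algebra ℚ R]
      (A : Matrix (Fin (2 * m)) (Fin (2 * m)) R), A.transpose = -A → A.det ≠ 0 →
      pfaffian A ^ 2 = algebraMap ℚ R κ * A.det := by
  -- The constant is the squared Pfaffian of the standard symplectic matrix, of determinant 1; other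
  -- matrices reduce to it over the fraction field.
  refine ⟨(1 / (2 ^ m * (Nat.factorial m : ℚ)) * pfSum (symplecticMatrix m)) ^ 2,
    pow_ne_zero _ (mul_ne_zero (by positivity)
      (by exact_mod_cast (pfSum_symplecticMatrix_pos m).ne')), ?_⟩
  intro R _ _ _ A hA hdet
  have : CharZero R := algebraRat.charZero R
  let K := FractionRing R
  let φ : R →+* K := algebraMap R K
  have hφ : Function.Injective φ := IsFractionRing.injective R K
  have : CharZero K := charZero_of_injective_ringHom hφ
  let A' : Matrix (Fin 2 × Fin m) (Fin 2 × Fin m) R := A.submatrix (pairEquiv m) (pairEquiv m)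
  have hA' : A'.transpose = -A' := by
    ext x y
    exact congrFun (congrFun hA (pairEquiv m x)) (pairEquiv m y)
  have hdet' : A'.det = A.det := Matrix.det_submatrix_equiv_self _ _
  have hAφ : (A'.map φ).transpose = -(A'.map φ) := by
    rw [← Matrix.transpose_map, hA']
    ext x y
    simp
  have hdetφ : (A'.map φ).det = φ A.det := by
    rw [← hdet', RingHom.map_det]
    rfl
  have key : pfSum A' ^ 2 = ((pfSum (symplecticMatrix m) : ℤ) : R) ^ 2 * A.det := by
    obtain ⟨B, hB⟩ := exists_mul_mul_transpose_eq hAφ (by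
      rw [hdetφ]
      exact fun h => hdet (hφ (h.trans (map_zero φ).symm)))
    have h1 := congrArg pfSum hB
    have h2 := congrArg Matrix.det hB
    rw [pfSum_mul_mul_transpose, ← map_pfSum, ← map_pfSum] at h1
    rw [Matrix.det_mul, Matrix.det_mul, Matrix.det_transpose, hdetφ, ← RingHom.mapMatrix_apply,
      ← RingHom.map_det, det_symplecticMatrix, map_one] at h2
    apply hφ
    rw [map_pow, map_mul, map_pow, map_intCast]
    rw [eq_intCast] at h1
    rw [← h1]
    linear_combination (-(φ (pfSum A')) ^ 2) * h2
  rw [pfaffian_eq, mul_pow, key, map_pow, map_mul, map_intCast]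
  ring

end Symplectic

/-! ### The rectangular Schur function -/

/-- The constant in `oddShift_schurFn_rectangle`. -/
def rectangleConst (k : ℕ) : ℤ :=
  Equiv.Perm.sign (Fin.revPerm : Equiv.Perm (Fin (k + 1))) * hankelConst k

theorem rectangleConst_ne_zero (k : ℕ) : rectangleConst k ≠ 0 :=
  mul_ne_zero (by simp) (hankelConst_ne_zero k)

/-- Reversing the rows of det(h_{k-i+j}) gives a Hankel determinant, and the series with times (t +
c)_odd is the square of the one with half these times. -/
theorem oddShift_schurFn_rectangle (k : ℕ) (c : ℕ+ → ℂ) :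
    oddShift c (schurFn (rectangle k)) = rectangleConst k * halfShift c (kdvTau k) ^ 2 := by
  let u : ℕ+ → TimePoly := oddOnly fun i =>
    MvPolynomial.C (1 / 2 : ℂ) * (MvPolynomial.X i + MvPolynomial.C (c i))
  let E : PowerSeries TimePoly := expTimes u
  have hE : E * PowerSeries.rescale (-1) E = 1 := expTimes_oddOnly_mul_rescale _
  have hhalf : halfShift c (kdvTau k) = stairDet E k := by
    have h := map_kdvTau (MvPolynomial.bind₁ (fun i => MvPolynomial.C (1 / 2 : ℂ) *
      ((MvPolynomial.X i : TimePoly) + MvPolynomial.C (c i)))).toRingHom k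
    simp only [AlgHom.toRingHom_eq_coe, RingHom.coe_coe, MvPolynomial.bind₁_X_right] at h
    rw [halfShift_eq_bind₁, h, ← stairDet_expTimes_oddOnly]
  have hsq : E * E = expTimes (oddOnly fun i =>
      (MvPolynomial.X i : TimePoly) + MvPolynomial.C (c i)) := by
    rw [← expTimes_add]
    congr 1
    funext i
    have h2 : (MvPolynomial.C (1 / 2 : ℂ) : TimePoly) + MvPolynomial.C (1 / 2 : ℂ) = 1 := by
      rw [← map_add]
      norm_num
    by_cases hi : Odd (i : ℕ)
    · simp only [u, oddOnly, hi, if_true, Pi.add_apply]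
      linear_combination (MvPolynomial.X i + MvPolynomial.C (c i)) * h2
    · simp [u, oddOnly, hi]
  let f : TimePoly →+* TimePoly := (MvPolynomial.bind₁ (oddOnly fun i =>
      (MvPolynomial.X i : TimePoly) + MvPolynomial.C (c i))).toRingHom
  have hf : ∀ n, f (elemSchur n) = zcoeff (E * E) n := fun n => by
    rw [map_elemSchur, hsq]
    simp [f]
  change f (schurFn (rectangle k)) = _
  have hmat : f (schurFn (rectangle k)) = Matrix.det (Matrix.submatrix
      (Matrix.of fun q j : Fin (k + 1) => PowerSeries.coeff ((q : ℕ) + (j : ℕ)) (E * E))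
      Fin.revPerm id) := by
    rw [schurFn, RingHom.map_det]
    congr 1
    ext1 i j
    simp only [RingHom.mapMatrix_apply, Matrix.map_apply, Matrix.of_apply, hf,
      Matrix.submatrix_apply, Fin.revPerm_apply, Fin.val_rev, id, rectangle]
    rw [← zcoeff_natCast]
    congr 1
    omega
  rw [hmat, Matrix.det_permute, det_hankel_sq hE, hhalf, rectangleConst]
  push_cast
  ring

/-! ### Schur Q-functions of staircases -/

/-- The generating series `∑ s_n(t₁, 0, t₃, 0, …) z^n`. -/
def oddSchurSeries : PowerSeries TimePoly := expTimes (oddOnly fun i => MvPolynomial.X i)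

theorem oddSchurSeries_mul_rescale :
    oddSchurSeries * PowerSeries.rescale (-1) oddSchurSeries = 1 :=
  expTimes_oddOnly_mul_rescale _

theorem kdvTau_eq_stairDet_oddSchurSeries (k : ℕ) : kdvTau k = stairDet oddSchurSeries k := by
  rw [kdvTau_eq, oddSchurSeries, stairDet_expTimes_oddOnly]

theorem qRow_eq (n : ℕ) : qRow n = PowerSeries.coeff n (oddSchurSeries * oddSchurSeries) := by
  have h : (oddOnly fun i => 2 * (MvPolynomial.X i : TimePoly)) =
      oddOnly (fun i => MvPolynomial.X i) + oddOnly fun i => MvPolynomial.X i := by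
    funext i
    rw [Pi.add_apply]
    by_cases hi : Odd (i : ℕ)
    · simp only [oddOnly, if_pos hi, two_mul]
    · simp only [oddOnly, if_neg hi, add_zero]
  rw [qRow, h, expTimes_add, oddSchurSeries]

theorem qRow_zero : qRow 0 = 1 := by
  simp [qRow, constantCoeff_expTimes]

theorem qPair_eq (r s : ℕ) : qPair r s =
    2 * ∑ i ∈ Finset.range (s + 1), (-1) ^ i * (qRow (r + i) * qRow (s - i)) - qRow r * qRow s := by
  rw [qPair, Finset.range_eq_Ico, Finset.sum_eq_sum_Ico_succ_bot (Nat.succ_pos s),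
    show Finset.Ico (0 + 1) (s + 1) = Finset.Icc 1 s by ext; simp]
  simp only [pow_zero, one_mul, add_zero, Nat.sub_zero]
  ring

theorem sum_qRow_mul_qRow {n : ℕ} (hn : n ≠ 0) :
    ∑ a ∈ Finset.range (n + 1), (-1) ^ a * (qRow a * qRow (n - a)) = 0 := by
  have h : oddSchurSeries * oddSchurSeries *
      PowerSeries.rescale (-1) (oddSchurSeries * oddSchurSeries) = 1 := by
    rw [map_mul, mul_mul_mul_comm, oddSchurSeries_mul_rescale, one_mul]
  have h2 := congrArg (PowerSeries.coeff n) h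
  rw [mul_comm, PowerSeries.coeff_mul, Finset.Nat.sum_antidiagonal_eq_sum_range_succ_mk,
    PowerSeries.coeff_one, if_neg hn] at h2
  rw [← h2]
  refine Finset.sum_congr rfl fun a _ => ?_
  rw [PowerSeries.coeff_rescale, qRow_eq, qRow_eq, mul_assoc]

/-- In degree r + s the identity S(z)S(-z) = 1 for S = ∑ q_n z^n is an alternating sum of the q_a
q_{r+s-a}; its terms with a ≥ r are the sum in Q_{(r,s)}, those with a < r the sum in Q_{(s,r)}
without its boundary term. -/
theorem qPair_swap {r s : ℕ} (h : r + s ≠ 0) : qPair s r = -qPair r s := by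
  have h1 := sum_qRow_mul_qRow h
  rw [add_assoc, Finset.sum_range_add] at h1
  have h2 : ∑ i ∈ Finset.range (s + 1), (-1) ^ (r + i) * (qRow (r + i) * qRow (r + s - (r + i))) =
      (-1) ^ r * ∑ i ∈ Finset.range (s + 1), (-1) ^ i * (qRow (r + i) * qRow (s - i)) := by
    rw [Finset.mul_sum]
    refine Finset.sum_congr rfl fun i _ => ?_
    rw [Nat.add_sub_add_left, pow_add, mul_assoc]
  have hsq : ((-1 : TimePoly) ^ r) * (-1) ^ r = 1 := by rw [← mul_pow]; simp
  have h3 : ∑ i ∈ Finset.range (r + 1), (-1) ^ i * (qRow (s + i) * qRow (r - i)) =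
      (-1) ^ r * ∑ a ∈ Finset.range r, (-1) ^ a * (qRow a * qRow (r + s - a)) +
        qRow r * qRow s := by
    rw [← Finset.sum_range_reflect, Finset.sum_range_succ, Finset.mul_sum]
    congr 1
    · refine Finset.sum_congr rfl fun a ha => ?_
      rw [Finset.mem_range] at ha
      obtain ⟨b, rfl⟩ := Nat.exists_eq_add_of_lt ha
      rw [show a + b + 1 + 1 - 1 - a = b + 1 by omega, show a + b + 1 - (b + 1) = a by omega,
        show a + b + 1 + s - a = s + (b + 1) by omega, add_assoc, pow_add (-1 : TimePoly) a]
      have : ((-1 : TimePoly) ^ a) * (-1) ^ a = 1 := by rw [← mul_pow]; simp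
      linear_combination (-(-1) ^ (b + 1) * qRow (s + (b + 1)) * qRow a) * this
    · simp [mul_comm]
  rw [qPair_eq, qPair_eq, h3]
  rw [h2] at h1
  linear_combination (2 * (-1) ^ r) * h1 -
    2 * (∑ i ∈ Finset.range (s + 1), (-1) ^ i * (qRow (r + i) * qRow (s - i))) * hsq

/-- The matrix of the `Q_{(r, s)}`, with zeros on the diagonal. -/
def qMatrix {n : ℕ} (f : Fin n → ℕ) : Matrix (Fin n) (Fin n) TimePoly :=
  Matrix.of fun i j => if i = j then 0 else qPair (f i) (f j)

theorem transpose_qMatrix {n : ℕ} {f : Fin n → ℕ} (hf : Function.Injective f) :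
    (qMatrix f).transpose = -qMatrix f := by
  ext1 i j
  rw [Matrix.transpose_apply, Matrix.neg_apply, qMatrix, Matrix.of_apply, Matrix.of_apply]
  by_cases h : i = j
  · simp [h]
  · rw [if_neg h, if_neg (Ne.symm h)]
    have := hf.ne h
    exact qPair_swap (by omega)

theorem det_eq_zero_of_transpose_eq_neg {n : ℕ} (hn : Odd n)
    {A : Matrix (Fin n) (Fin n) TimePoly} (hA : A.transpose = -A) : A.det = 0 := by
  have h := Matrix.det_transpose A
  rw [hA, Matrix.det_neg, Fintype.card_fin, hn.neg_one_pow, neg_one_mul] at h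
  exact self_eq_neg.1 h.symm

theorem qPair_self {r : ℕ} (hr : r ≠ 0) : qPair r r = 0 :=
  self_eq_neg.1 (qPair_swap (by omega))

theorem qPair_zero_zero : qPair 0 0 = 1 := by
  simp [qPair, qRow_zero]

/-- The constant in `det_qPair`. -/
def qConst (k : ℕ) : ℤ :=
  hankelConst k * ∏ j : Fin (k + 1), (2 * (-1) ^ (j : ℕ) - if (j : ℕ) = 0 then 1 else 0)

theorem qConst_ne_zero (k : ℕ) : qConst k ≠ 0 := by
  refine mul_ne_zero (hankelConst_ne_zero k) (Finset.prod_ne_zero_iff.2 fun j _ => ?_)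
  rcases neg_one_pow_eq_or ℤ (j : ℕ) with h | h <;> rw [h] <;> split_ifs <;> norm_num

/-- Q_{(r,s)} is the sum of ε_j q_{r+j} q_{s-j} with ε_0 = 1 and ε_j = 2(-1)^j for j > 0: a Hankel
matrix times a triangular one with diagonal ε_j. -/
theorem det_qPair (k : ℕ) :
    Matrix.det (Matrix.of fun r s : Fin (k + 1) => qPair (r : ℕ) (s : ℕ)) =
      qConst k * kdvTau k ^ 2 := by
  let S := oddSchurSeries * oddSchurSeries
  have hS : zcoeff S 0 = 1 := by
    have h := qRow_zero
    rw [qRow_eq, ← zcoeff_natCast] at h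
    exact h
  let N : Matrix (Fin (k + 1)) (Fin (k + 1)) TimePoly := Matrix.of fun j s =>
    ((2 * (-1) ^ (j : ℕ) - if (j : ℕ) = 0 then 1 else 0 : ℤ) : TimePoly) *
      zcoeff S (((s : ℕ) : ℤ) - (j : ℕ))
  have hprod : (Matrix.of fun r s : Fin (k + 1) => qPair (r : ℕ) (s : ℕ)) =
      (Matrix.of fun q j : Fin (k + 1) => PowerSeries.coeff ((q : ℕ) + (j : ℕ)) S) * N := by
    ext1 r s
    have hs := s.2
    rw [Matrix.mul_apply]
    simp only [N, Matrix.of_apply]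
    rw [Fin.sum_univ_eq_sum_range (fun j => PowerSeries.coeff ((r : ℕ) + j) S *
      (((2 * (-1) ^ j - if j = 0 then 1 else 0 : ℤ) : TimePoly) *
        zcoeff S (((s : ℕ) : ℤ) - (j : ℕ)))), qPair_eq,
      ← Finset.sum_subset (Finset.range_mono (by omega : (s : ℕ) + 1 ≤ k + 1))]
    · rw [Finset.sum_range_succ', Finset.sum_range_succ', mul_add, Finset.mul_sum, add_sub_assoc]
      congr 1
      · refine Finset.sum_congr rfl fun j hj => ?_
        rw [Finset.mem_range] at hj
        rw [qRow_eq, qRow_eq, if_neg (Nat.succ_ne_zero j),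
          show (((s : ℕ) : ℤ) - (j + 1 : ℕ)) = (((s : ℕ) - (j + 1) : ℕ) : ℤ) by omega,
          zcoeff_natCast]
        push_cast
        ring
      · simp only [qRow_eq]
        simp [S]
        ring
    · intro j _ hj
      rw [Finset.mem_range] at hj
      rw [zcoeff_of_neg _ (by omega), mul_zero, mul_zero]
  have hN : N.det = ((∏ j : Fin (k + 1), (2 * (-1) ^ (j : ℕ) - if (j : ℕ) = 0 then 1 else 0) : ℤ) :
      TimePoly) := by
    rw [Matrix.det_of_isUpperTriangular, Int.cast_prod]
    · refine Finset.prod_congr rfl fun j _ => ?_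
      simp only [N, Matrix.of_apply, sub_self, hS, mul_one]
    · intro i j hij
      have : (j : ℕ) < i := hij
      simp only [N, Matrix.of_apply]
      rw [zcoeff_of_neg _ (by omega), mul_zero]
  rw [hprod, Matrix.det_mul, hN, det_hankel_sq oddSchurSeries_mul_rescale,
    kdvTau_eq_stairDet_oddSchurSeries, qConst]
  push_cast
  ring

/-- The two matrices differ only in the corner, where Q_{(0,0)} = 1 replaces 0; the corner minor is
the matrix on the indices 1, …, k. -/
theorem det_qPair_eq_add (k : ℕ) :
    Matrix.det (Matrix.of fun r s : Fin (k + 1) => qPair (r : ℕ) (s : ℕ)) =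
      (qMatrix fun i : Fin (k + 1) => (i : ℕ)).det +
        (qMatrix fun i : Fin k => (i : ℕ) + 1).det := by
  have hne : ∀ r s : Fin (k + 1), r ≠ 0 ∨ s ≠ 0 →
      qPair (r : ℕ) (s : ℕ) = qMatrix (fun i : Fin (k + 1) => (i : ℕ)) r s := by
    intro r s hrs
    rw [qMatrix, Matrix.of_apply]
    split_ifs with h
    · subst h
      exact qPair_self (by simpa using hrs)
    · rfl
  rw [Matrix.det_succ_row_zero, Matrix.det_succ_row_zero (qMatrix _), Fin.sum_univ_succ,
    Fin.sum_univ_succ (n := k)]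
  have hminor : ∀ j : Fin (k + 1), (Matrix.of fun r s : Fin (k + 1) =>
      qPair (r : ℕ) (s : ℕ)).submatrix Fin.succ j.succAbove =
      (qMatrix fun i : Fin (k + 1) => (i : ℕ)).submatrix Fin.succ j.succAbove := fun j => by
    ext1 r s
    exact hne _ _ (Or.inl (Fin.succ_ne_zero r))
  have h0 : (qMatrix fun i : Fin (k + 1) => (i : ℕ)).submatrix Fin.succ (Fin.succAbove 0) =
      qMatrix fun i : Fin k => (i : ℕ) + 1 := by
    ext1 r s
    simp [qMatrix]
  have h00 : qMatrix (fun i : Fin (k + 1) => (i : ℕ)) 0 0 = 0 := by simp [qMatrix]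
  simp only [hminor, Matrix.of_apply, h0, h00, hne 0 _ (Or.inr (Fin.succ_ne_zero _))]
  simp only [Fin.val_zero, qPair_zero_zero]
  ring

/-- Of the skew-symmetric matrices of sizes k and k + 1, the odd one has determinant zero. The even
one is the matrix of the staircase, extended by a part 0 precisely when k is odd. -/
theorem det_qMatrix_staircase {k n : ℕ} (hn : Even n) (h : n = k ∨ n = k + 1) :
    (qMatrix fun i : Fin n => k - (i : ℕ)).det = qConst k * kdvTau k ^ 2 := by
  rw [← det_qPair, det_qPair_eq_add]
  rcases h with rfl | rfl
  · rw [det_eq_zero_of_transpose_eq_neg hn.add_one (transpose_qMatrix fun i j h => Fin.ext h),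
      zero_add, ← Matrix.det_submatrix_equiv_self Fin.revPerm]
    congr 1
    ext1 i j
    have hi := i.2
    have hj := j.2
    simp only [qMatrix, Matrix.submatrix_apply, Matrix.of_apply, Fin.revPerm_apply, Fin.val_rev,
      Fin.rev_inj]
    rw [show n - (n - (i + 1) : ℕ) = (i : ℕ) + 1 by omega,
      show n - (n - (j + 1) : ℕ) = (j : ℕ) + 1 by omega]
  · have hk : Odd k := by
      rcases Nat.even_or_odd k with h | h
      · exact absurd hn (Nat.not_even_iff_odd.2 h.add_one)
      · exact h
    rw [det_eq_zero_of_transpose_eq_neg (A := qMatrix fun i : Fin k => (i : ℕ) + 1) hk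
      (transpose_qMatrix fun i j h => Fin.ext (Nat.succ_injective h)),
      add_zero, ← Matrix.det_submatrix_equiv_self Fin.revPerm]
    congr 1
    ext1 i j
    have hi := i.2
    have hj := j.2
    simp only [qMatrix, Matrix.submatrix_apply, Matrix.of_apply, Fin.revPerm_apply, Fin.val_rev,
      Fin.rev_inj]
    rw [show k - (k + 1 - (i + 1) : ℕ) = (i : ℕ) by omega,
      show k - (k + 1 - (j + 1) : ℕ) = (j : ℕ) by omega]

theorem schurQ_staircase_eq (k : ℕ) : schurQ (staircase k) =
    pfaffian (m := (k + 1) / 2) (qMatrix fun i => k - (i : ℕ)) := by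
  have h : ∀ i : Fin (2 * ((k + 1) / 2)),
      (if h : (i : ℕ) < k then staircase k ⟨i, h⟩ else 0) = k - (i : ℕ) := fun i => by
    split_ifs with h
    · rfl
    · omega
  simp only [schurQ, h]
  rfl

theorem exists_kdvTau_eq_smul_schurQ (k : ℕ) :
    ∃ a : ℂ, a ≠ 0 ∧ kdvTau k = a • schurQ (staircase k) := by
  obtain ⟨κ, hκ, hpf⟩ := exists_pfaffian_sq_eq ((k + 1) / 2)
  have hdet := det_qMatrix_staircase (k := k) (n := 2 * ((k + 1) / 2)) (even_two_mul _) (by omega)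
  have hconst : ((qConst k : ℤ) : TimePoly) ≠ 0 := Int.cast_ne_zero.2 (qConst_ne_zero k)
  have hsq := hpf (qMatrix fun i : Fin (2 * ((k + 1) / 2)) => k - (i : ℕ))
    (transpose_qMatrix fun i j h => Fin.ext (by have := i.2; have := j.2; omega))
    (by rw [hdet]; exact mul_ne_zero hconst (pow_ne_zero _ (kdvTau_ne_zero k)))
  rw [← schurQ_staircase_eq, hdet] at hsq
  obtain ⟨γ, hγ⟩ := IsAlgClosed.exists_pow_nat_eq ((κ : ℂ) * (qConst k : ℂ)) (n := 2) (by norm_num)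
  have hγ0 : γ ≠ 0 := by
    rintro rfl
    rw [zero_pow two_ne_zero, eq_comm, mul_eq_zero] at hγ
    rcases hγ with h | h
    · exact hκ (by exact_mod_cast h)
    · exact qConst_ne_zero k (by exact_mod_cast h)
  have hC : (MvPolynomial.C γ : TimePoly) ^ 2 = algebraMap ℚ TimePoly κ * qConst k := by
    rw [← map_pow, hγ, map_mul]
    congr 1
  -- Since Q² = γ² τ_k² in a domain, Q = ±γ τ_k; the sign need not be determined.
  have hfac : (schurQ (staircase k) - MvPolynomial.C γ * kdvTau k) *
      (schurQ (staircase k) + MvPolynomial.C γ * kdvTau k) = 0 := by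
    linear_combination hsq - kdvTau k ^ 2 * hC
  rcases mul_eq_zero.1 hfac with h | h
  · refine ⟨γ⁻¹, inv_ne_zero hγ0, ?_⟩
    rw [sub_eq_zero.1 h, ← MvPolynomial.smul_eq_C_mul, smul_smul, inv_mul_cancel₀ hγ0, one_smul]
  · refine ⟨-γ⁻¹, neg_ne_zero.2 (inv_ne_zero hγ0), ?_⟩
    rw [eq_neg_of_add_eq_zero_left h, ← MvPolynomial.smul_eq_C_mul, neg_smul, smul_neg, neg_neg,
      smul_smul, inv_mul_cancel₀ hγ0, one_smul]

theorem halfShift_smul (c : ℕ+ → ℂ) (a : ℂ) (τ : TimePoly) :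
    halfShift c (a • τ) = a • halfShift c τ := by
  rw [halfShift_eq_bind₁, halfShift_eq_bind₁, MvPolynomial.smul_eq_C_mul,
    MvPolynomial.smul_eq_C_mul, map_mul, MvPolynomial.bind₁_C_right]

end KdVBKP

end

theorem mainTheorem3 :
    -- the polynomial KdV tau-functions are, up to nonzero scalars, the `τ_k(t + c)`
    (∀ τ : KdVBKP.TimePoly, KdVBKP.IsKdVTau τ ↔
      ∃ (k : ℕ) (c : ℕ+ → ℂ) (a : ℂ), a ≠ 0 ∧ τ = a • KdVBKP.shift c (KdVBKP.kdvTau k)) ∧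
    -- halving the times turns each of them into a BKP tau-function
    (∀ (k : ℕ) (c : ℕ+ → ℂ), KdVBKP.IsBKPTau (KdVBKP.halfShift c (KdVBKP.kdvTau k))) ∧
    -- which is, up to nonzero constants, a Schur Q-function and the square root of a Schur function
    (∀ k : ℕ, ∃ a b : ℂ, a ≠ 0 ∧ b ≠ 0 ∧ ∀ c : ℕ+ → ℂ,
      KdVBKP.halfShift c (KdVBKP.kdvTau k)
          = a • KdVBKP.halfShift c (KdVBKP.schurQ (KdVBKP.staircase k)) ∧
      (KdVBKP.halfShift c (KdVBKP.kdvTau k)) ^ 2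
          = b • KdVBKP.oddShift c (KdVBKP.schurFn (KdVBKP.rectangle k))) := by
  refine ⟨KdVBKP.isKdVTau_iff, KdVBKP.isBKPTau_halfShift_kdvTau, fun k => ?_⟩
  obtain ⟨a, ha, h⟩ := KdVBKP.exists_kdvTau_eq_smul_schurQ k
  have hb : ((KdVBKP.rectangleConst k : ℤ) : ℂ) ≠ 0 :=
    Int.cast_ne_zero.2 (KdVBKP.rectangleConst_ne_zero k)
  refine ⟨a, ((KdVBKP.rectangleConst k : ℤ) : ℂ)⁻¹, ha, inv_ne_zero hb, fun c => ⟨?_, ?_⟩⟩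
  · rw [← KdVBKP.halfShift_smul, ← h]
  · have hC : ((KdVBKP.rectangleConst k : ℤ) : KdVBKP.TimePoly) =
        MvPolynomial.C ((KdVBKP.rectangleConst k : ℤ) : ℂ) := by simp
    rw [KdVBKP.oddShift_schurFn_rectangle, hC, ← MvPolynomial.smul_eq_C_mul, smul_smul,
      inv_mul_cancel₀ hb, one_smul]
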